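/- **Theorem (topological zero-one law for filtrations).** Let $(\Omega,P)$ be a standard Borel space with a nonatomic probability measure (for example $(0,1)$ with Lebesgue measure). Let $G$ be the group of invertible measure preserving maps $\Omega\to\Omega$, two maps being identified when they agree almost everywhere (equivalently, the group of measure preserving automorphisms of the measure algebra), with the topology of pointwise convergence on the measure algebra: $g_n\to g$ iff $P(g_nA\,\triangle\,gA)\to 0$ for every measurable $A$. A sub-$\sigma$-field is a $\sigma$-field consisting of measurable sets and containing all measurable sets of measure zero. The set of all sub-$\sigma$-fields carries the Wijsman topology of the closed subspaces $L_2(\mathcal E)\subset L_2(\Omega,P)$, that is, the topology of pointwise convergence of the functions $f\mapsto\min\bigl(1,\operatorname{dist}(f,L_2(\mathcal E))\bigr)$ on $L_2(\Omega,P)$; and $g\in G$ acts by $g\cdot\mathcal E=\{gA : A\in\mathcal E\}$. Let $X_1$ be the space of those sub-$\sigma$-fields $\mathcal E$ that are conditionally nonatomic, i.e. almost all conditional measures of $P$ given $\mathcal E$ are nonatomic. Let $T\subset[0,+\infty]$ be compact, and let $X_T\subset C(T,X_1)$ be the set of all continuous maps $t\mapsto\mathcal F_t$ from $T$ to $X_1$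 such that $\mathcal F_s\subset\mathcal F_t$ whenever $s\le t$, and such that $\mathcal F_t$ consists of sets of probability $0$ or $1$ only when $t$ is the least element of $T$. The space $C(T,X_1)$ carries the topology of uniform convergence, $X_T$ the subspace topology, and $G$ acts on $X_T$ by $g\cdot(\mathcal F_t)_{t\in T}=(g\cdot\mathcal F_t)_{t\in T}$. Then the space $X_T$ is ergodic, that is: $X_T$ is a Polish $G$-space ($G$ is a Polish group, $X_T$ is a Polish space, and the action $G\times X_T\to X_T$ is continuous), and every $G$-invariant set $A\subset X_T$ with the Baire property is meager or comeager in $X_T$. -/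

import Mathlib

open MeasureTheory ProbabilityTheory Set Filter
open scoped ENNReal

/-! ### Polish `G`-spaces and ergodicity -/

/-- `X` is a Polish `G`-space: `G` is a Polish group acting continuously on the Polish space `X`. -/
structure IsPolishGSpace (G X : Type*) [Group G] [TopologicalSpace G] [TopologicalSpace X]
    [MulAction G X] : Prop where
  isTopologicalGroup : IsTopologicalGroup G
  polishGroup : PolishSpace G
  polishSpace : PolishSpace X
  continuousSMul : ContinuousSMul G X

/-- A Polish `G`-space is ergodic if every `G`-invariant set with the Baire property is
meager or comeager. -/
structure IsErgodicGSpace (G X : Type*) [Group G] [TopologicalSpace G] [TopologicalSpace X]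
    [MulAction G X] : Prop where
  isPolishGSpace : IsPolishGSpace G X
  meager_or_comeager : ∀ A : Set X, (∀ g : G, ∀ x ∈ A, g • x ∈ A) → BaireMeasurableSet A →
    IsMeagre A ∨ A ∈ residual X

/-! ### The Wijsman topology -/

/-- The Wijsman topology on the closed subsets of a metric space: the topology of pointwise
convergence of the distance functions `x ↦ min 1 (dist (x, F))`, where `dist (x, ∅) = ∞`. -/
noncomputable abbrev wijsmanTopology (X : Type*) [MetricSpace X] :
    TopologicalSpace (TopologicalSpace.Closeds X) :=
  TopologicalSpace.induced (fun F x => min 1 (Metric.infEDist x (F : Set X)))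
    (inferInstance : TopologicalSpace (X → ℝ≥0∞))

namespace ProbSpace

/-! ### The automorphism group of a probability space -/

section Aut

variable {Ω : Type*} [MeasurableSpace Ω] (P : Measure Ω)

/-- The group of invertible measure preserving maps `Ω → Ω` (not yet identified mod 0). -/
def mpPerm : Subgroup (Equiv.Perm Ω) where
  carrier := {e | MeasurePreserving e P P ∧ MeasurePreserving e.symm P P}
  one_mem' := ⟨MeasurePreserving.id P, MeasurePreserving.id P⟩
  mul_mem' ha hb := ⟨ha.1.comp hb.1, hb.2.comp ha.2⟩
  inv_mem' ha := ⟨ha.2, ha.1⟩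

/-- The invertible measure preserving maps that are equal to the identity almost everywhere. -/
def nullPerm : Subgroup (mpPerm P) where
  carrier := {e | ∀ᵐ ω ∂P, (e : Equiv.Perm Ω) ω = ω}
  one_mem' := by
    show ∀ᵐ ω ∂P, (1 : Equiv.Perm Ω) ω = ω
    simp
  mul_mem' {a b} ha hb := by
    have hb' : ∀ᵐ ω ∂P, (b : Equiv.Perm Ω) ω = ω := hb
    have ha' : ∀ᵐ ω ∂P, (a : Equiv.Perm Ω) ω = ω := ha
    show ∀ᵐ ω ∂P, (a : Equiv.Perm Ω) ((b : Equiv.Perm Ω) ω) = ω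
    filter_upwards [ha', hb'] with ω h1 h2
    rw [h2, h1]
  inv_mem' {a} ha := by
    have ha' : ∀ᵐ ω ∂P, (a : Equiv.Perm Ω) ω = ω := ha
    show ∀ᵐ ω ∂P, (a : Equiv.Perm Ω).symm ω = ω
    filter_upwards [ha'] with ω h
    rw [Equiv.symm_apply_eq, h]

instance nullPerm_normal : (nullPerm P).Normal where
  conj_mem n hn g := by
    have hn' : ∀ᵐ ω ∂P, (n : Equiv.Perm Ω) ω = ω := hn
    show ∀ᵐ ω ∂P,
      (g : Equiv.Perm Ω) ((n : Equiv.Perm Ω) ((g : Equiv.Perm Ω).symm ω)) = ω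
    filter_upwards [g.2.2.quasiMeasurePreserving.ae hn'] with ω h
    rw [h, Equiv.apply_symm_apply]

/-- The image of a measurable set under an invertible measure preserving map. -/
def imageSet (e : mpPerm P) (s : MeasuredSets P) : MeasuredSets P :=
  ⟨(e : Equiv.Perm Ω) '' s.1, by
    rw [Equiv.image_eq_preimage_symm]
    exact e.2.2.measurable s.2⟩

/-- The topology of pointwise convergence on the measure algebra: `e n → e` iff
`P (e n '' s ∆ e '' s) → 0` for every measurable set `s`. -/
noncomputable instance mpPermTopology : TopologicalSpace (mpPerm P) :=
  TopologicalSpace.induced (fun e s => imageSet P e s)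
    (inferInstance : TopologicalSpace (MeasuredSets P → MeasuredSets P))

/-- The group `Aut (Ω, P)` of (equivalence classes mod 0 of) measure preserving automorphisms. On a
nonatomic standard Borel probability space this is the group of all measure preserving
automorphisms of the measure algebra of `P`, since each of these is induced by an invertible
measure preserving map `Ω → Ω`. The topology is the quotient topology, which is the topology of
pointwise convergence on the measure algebra. -/
abbrev Aut : Type _ := mpPerm P ⧸ nullPerm P

end Aut

/-! ### Sub-σ-fields -/

section SubSigmaField

variable {Ω : Type*} [mΩ : MeasurableSpace Ω] (P : Measure Ω)

/-- A sub-σ-field (containing all sets of measure zero). -/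
structure SubSigmaField where
  toMeasurableSpace : MeasurableSpace Ω
  le : toMeasurableSpace ≤ mΩ
  measurableSet_of_null : ∀ s, MeasurableSet[mΩ] s → P s = 0 → MeasurableSet[toMeasurableSpace] s

variable {P}

namespace SubSigmaField

lemma ext : ∀ {E F : SubSigmaField P}, E.toMeasurableSpace = F.toMeasurableSpace → E = F
  | ⟨_, _, _⟩, ⟨_, _, _⟩, rfl => rfl

/-- A sub-σ-field `E` as the closed subspace `L₂(E)` of `L₂(Ω, P)`. -/
noncomputable def toClosedSubspace (E : SubSigmaField P) :
    TopologicalSpace.Closeds (Lp ℝ 2 P) where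
  carrier := (lpMeas ℝ ℝ E.toMeasurableSpace 2 P : Set (Lp ℝ 2 P))
  isClosed' := isClosed_aestronglyMeasurable E.le

/-- The Wijsman topology on sub-σ-fields, these being treated as subspaces of `L₂(Ω, P)`. -/
noncomputable instance : TopologicalSpace (SubSigmaField P) :=
  TopologicalSpace.induced toClosedSubspace (wijsmanTopology (Lp ℝ 2 P))

/-- The image of a sub-σ-field under an invertible measure preserving map: a set belongs to it iff
its preimage belongs to the given sub-σ-field. -/
def image (e : mpPerm P) (E : SubSigmaField P) : SubSigmaField P where
  toMeasurableSpace := E.toMeasurableSpace.map (e : Equiv.Perm Ω)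
  le := fun s hs => by
    have h := e.2.2.measurable (E.le _ hs)
    rwa [← preimage_comp, Equiv.self_comp_symm, preimage_id] at h
  measurableSet_of_null := fun s hs h0 =>
    E.measurableSet_of_null _ (e.2.1.measurable hs) (by
      rw [e.2.1.measure_preimage hs.nullMeasurableSet, h0])

instance : MulAction (mpPerm P) (SubSigmaField P) where
  smul := image
  one_smul _ := rfl
  mul_smul _ _ _ := rfl

lemma measurableSet_smul {e : mpPerm P} {E : SubSigmaField P} {s : Set Ω} :
    MeasurableSet[(e • E).toMeasurableSpace] s ↔
      MeasurableSet[E.toMeasurableSpace] ((e : Equiv.Perm Ω) ⁻¹' s) := Iff.rfl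

/-- Sub-σ-fields do not distinguish sets that are equal mod 0. -/
lemma measurableSet_congr (E : SubSigmaField P) {s t : Set Ω} (hs : MeasurableSet s)
    (ht : MeasurableSet t) (h : s =ᵐ[P] t) (hE : MeasurableSet[E.toMeasurableSpace] s) :
    MeasurableSet[E.toMeasurableSpace] t := by
  have h1 : MeasurableSet[E.toMeasurableSpace] (s \ t) :=
    E.measurableSet_of_null _ (hs.diff ht) (ae_le_set.1 h.le)
  have h2 : MeasurableSet[E.toMeasurableSpace] (t \ s) :=
    E.measurableSet_of_null _ (ht.diff hs) (ae_le_set.1 h.symm.le)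
  have h3 : t = (s \ (s \ t)) ∪ (t \ s) := by
    ext x
    simp only [mem_union, Set.mem_sdiff]
    tauto
  rw [h3]
  exact (hE.diff h1).union h2

lemma smul_eq_of_mem_nullPerm {e : mpPerm P} (he : e ∈ nullPerm P) (E : SubSigmaField P) :
    e • E = E := by
  have he' : ∀ᵐ ω ∂P, (e : Equiv.Perm Ω) ω = ω := he
  have key : ∀ s : Set Ω, ((e : Equiv.Perm Ω) ⁻¹' s : Set Ω) =ᵐ[P] s := fun s => by
    filter_upwards [he'] with ω h
    show ((e : Equiv.Perm Ω) ω ∈ s) = (ω ∈ s)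
    rw [h]
  refine SubSigmaField.ext (MeasurableSpace.ext fun s => ⟨fun h => ?_, fun h => ?_⟩)
  · exact E.measurableSet_congr (E.le _ (measurableSet_smul.1 h)) ((e • E).le _ h) (key s)
      (measurableSet_smul.1 h)
  · exact measurableSet_smul.2 (E.measurableSet_congr (E.le _ h)
      (e.2.1.measurable (E.le _ h)) (key s).symm h)

/-- The action `Aut (Ω, P) → Perm (SubSigmaField P)`: the class of `e` sends `E` to `e • E`. -/
def autHom (P : Measure Ω) : Aut P →* Equiv.Perm (SubSigmaField P) :=
  QuotientGroup.lift (nullPerm P) (MulAction.toPermHom (mpPerm P) (SubSigmaField P))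
    (fun _ he => Equiv.ext fun E => smul_eq_of_mem_nullPerm he E)

instance : MulAction (Aut P) (SubSigmaField P) := MulAction.compHom _ (autHom P)

lemma mk_smul (e : mpPerm P) (E : SubSigmaField P) :
    (QuotientGroup.mk e : Aut P) • E = e • E := rfl

/-- The isometry `f ↦ f ∘ e` of `L₂(Ω, P)` sends `L₂(e • E)` onto `L₂(E)`. -/
lemma image_toClosedSubspace_smul (e : mpPerm P) (E : SubSigmaField P) :
    Lp.compMeasurePreserving (e : Equiv.Perm Ω) e.2.1 ''
      ((e • E).toClosedSubspace : Set (Lp ℝ 2 P)) = E.toClosedSubspace := by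
  have h1 : Measurable[E.toMeasurableSpace, (e • E).toMeasurableSpace] (e : Equiv.Perm Ω) :=
    fun s hs => measurableSet_smul.1 hs
  have h2 : Measurable[(e • E).toMeasurableSpace, E.toMeasurableSpace]
      (e : Equiv.Perm Ω).symm := fun s hs => measurableSet_smul.2 (by
    rwa [← preimage_comp, Equiv.symm_comp_self, preimage_id])
  apply Subset.antisymm
  · rintro _ ⟨g, ⟨g', hg', hgg'⟩, rfl⟩
    refine ⟨g' ∘ (e : Equiv.Perm Ω), hg'.comp_measurable h1, ?_⟩
    exact (Lp.coeFn_compMeasurePreserving g e.2.1).trans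
      (e.2.1.quasiMeasurePreserving.ae_eq_comp hgg')
  · rintro f ⟨f', hf', hff'⟩
    refine ⟨Lp.compMeasurePreserving (e : Equiv.Perm Ω).symm e.2.2 f,
      ⟨f' ∘ (e : Equiv.Perm Ω).symm, hf'.comp_measurable h2, ?_⟩, ?_⟩
    · exact (Lp.coeFn_compMeasurePreserving f e.2.2).trans
        (e.2.2.quasiMeasurePreserving.ae_eq_comp hff')
    · apply Lp.ext
      refine (Lp.coeFn_compMeasurePreserving _ e.2.1).trans ?_
      refine (e.2.1.quasiMeasurePreserving.ae_eq_comp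
        (Lp.coeFn_compMeasurePreserving f e.2.2)).trans ?_
      rw [Function.comp_assoc, Equiv.symm_comp_self, Function.comp_id]

lemma continuous_smul_const (e : mpPerm P) :
    Continuous fun E : SubSigmaField P => e • E := by
  rw [continuous_induced_rng, continuous_induced_rng, continuous_pi_iff]
  intro f
  have h : ∀ E : SubSigmaField P,
      min 1 (Metric.infEDist f ((e • E).toClosedSubspace : Set (Lp ℝ 2 P))) =
      min 1 (Metric.infEDist (Lp.compMeasurePreserving (e : Equiv.Perm Ω) e.2.1 f)
        (E.toClosedSubspace : Set (Lp ℝ 2 P))) := fun E => by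
    rw [← image_toClosedSubspace_smul e E,
      Metric.infEDist_image (Lp.isometry_compMeasurePreserving e.2.1)]
  have h1 : Continuous fun (F : SubSigmaField P) (x : Lp ℝ 2 P) =>
      min 1 (Metric.infEDist x (F.toClosedSubspace : Set (Lp ℝ 2 P))) :=
    continuous_iff_le_induced.2 (by
      rw [show (fun (F : SubSigmaField P) (x : Lp ℝ 2 P) =>
          min 1 (Metric.infEDist x (F.toClosedSubspace : Set (Lp ℝ 2 P)))) =
        (fun (F : TopologicalSpace.Closeds (Lp ℝ 2 P)) (x : Lp ℝ 2 P) =>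
          min 1 (Metric.infEDist x (F : Set (Lp ℝ 2 P)))) ∘ toClosedSubspace from rfl,
        ← induced_compose]
      exact le_rfl)
  simp only [Function.comp_def, h]
  exact (continuous_pi_iff.1 h1) (Lp.compMeasurePreserving (e : Equiv.Perm Ω) e.2.1 f)

/-- `E` is trivial if it consists of sets of probability `0` or `1` only. -/
def IsTrivial (E : SubSigmaField P) : Prop :=
  ∀ s, MeasurableSet[E.toMeasurableSpace] s → P s = 0 ∨ P s = 1

lemma IsTrivial.smul {E : SubSigmaField P} (h : E.IsTrivial) (e : mpPerm P) :
    (e • E).IsTrivial := fun s hs => by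
  have := h _ (measurableSet_smul.1 hs)
  rwa [e.2.1.measure_preimage ((e • E).le _ hs).nullMeasurableSet] at this

/-- `E` is conditionally nonatomic if almost all conditional measures given `E` are nonatomic. -/
def IsCondNonatomic [StandardBorelSpace Ω] [IsFiniteMeasure P] (E : SubSigmaField P) : Prop :=
  ∀ᵐ ω ∂P, NullSingletonClass (condExpKernel P E.toMeasurableSpace ω)

/-- Transport of conditional probabilities. -/
lemma condExp_smul_comp [IsFiniteMeasure P] (e : mpPerm P) (E : SubSigmaField P) {s : Set Ω}
    (hs : MeasurableSet s) :
    P⟦s | (e • E).toMeasurableSpace⟧ ∘ (e : Equiv.Perm Ω) =ᵐ[P]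
      P⟦(e : Equiv.Perm Ω) ⁻¹' s | E.toMeasurableSpace⟧ := by
  have h1 : Measurable[E.toMeasurableSpace, (e • E).toMeasurableSpace] (e : Equiv.Perm Ω) :=
    fun s hs => measurableSet_smul.1 hs
  have hemb : MeasurableEmbedding (e : Equiv.Perm Ω) :=
    MeasurableEquiv.measurableEmbedding
      ⟨(e : Equiv.Perm Ω), e.2.1.measurable, e.2.2.measurable⟩
  have hint : Integrable (P⟦s | (e • E).toMeasurableSpace⟧ ∘ (e : Equiv.Perm Ω)) P :=
    (e.2.1.integrable_comp_emb hemb).2 integrable_condExp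
  refine ae_eq_condExp_of_forall_setIntegral_eq E.le
    ((integrable_const (1 : ℝ)).indicator (e.2.1.measurable hs))
    (fun _ _ _ => hint.integrableOn) (fun A hA _ => ?_)
    (stronglyMeasurable_condExp.comp_measurable h1).aestronglyMeasurable
  set B : Set Ω := (e : Equiv.Perm Ω).symm ⁻¹' A with hB
  have hAB : (e : Equiv.Perm Ω) ⁻¹' B = A := by
    rw [hB, ← preimage_comp, Equiv.symm_comp_self, preimage_id]
  have hBm : MeasurableSet[(e • E).toMeasurableSpace] B :=
    measurableSet_smul.2 (by rwa [hAB])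
  rw [← hAB]
  simp only [Function.comp_def]
  rw [e.2.1.setIntegral_preimage_emb hemb
      (fun x => (P⟦s | (e • E).toMeasurableSpace⟧) x),
    setIntegral_condExp (e • E).le ((integrable_const (1 : ℝ)).indicator hs) hBm,
    ← e.2.1.setIntegral_preimage_emb hemb]
  rfl

lemma IsCondNonatomic.smul [StandardBorelSpace Ω] [IsFiniteMeasure P] {E : SubSigmaField P}
    (h : E.IsCondNonatomic) (e : mpPerm P) : (e • E).IsCondNonatomic := by
  have key : ∀ s : Set Ω, MeasurableSet s → ∀ᵐ ω ∂P,
      condExpKernel P (e • E).toMeasurableSpace ((e : Equiv.Perm Ω) ω) s =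
        (condExpKernel P E.toMeasurableSpace ω).map (e : Equiv.Perm Ω) s := fun s hs => by
    filter_upwards [e.2.1.quasiMeasurePreserving.ae
        (condExpKernel_ae_eq_condExp (e • E).le (μ := P) hs),
      condExpKernel_ae_eq_condExp E.le (μ := P) (e.2.1.measurable hs),
      condExp_smul_comp e E hs] with ω h1 h2 h3
    rw [Measure.map_apply e.2.1.measurable hs, ← measureReal_eq_measureReal_iff, h1, h2, ← h3]
    rfl
  set C := generateSetAlgebra (MeasurableSpace.countableGeneratingSet Ω) with hC
  have hCgen : MeasurableSpace.generateFrom C = mΩ := by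
    rw [hC, generateFrom_generateSetAlgebra_eq,
      MeasurableSpace.generateFrom_countableGeneratingSet]
  have hCc : C.Countable :=
    countable_generateSetAlgebra MeasurableSpace.countable_countableGeneratingSet
  have hCpi : IsPiSystem C := fun s hs t ht _ =>
    (isSetAlgebra_generateSetAlgebra).inter_mem hs ht
  have hCm : ∀ s ∈ C, MeasurableSet s := fun s hs => by
    rw [← hCgen]
    exact MeasurableSpace.measurableSet_generateFrom hs
  have hall := (ae_ball_iff hCc).2 fun s hs => key s (hCm s hs)
  have hmain : ∀ᵐ ω ∂P, NullSingletonClass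
      (condExpKernel P (e • E).toMeasurableSpace ((e : Equiv.Perm Ω) ω)) := by
    filter_upwards [hall, h, key univ MeasurableSet.univ] with ω h1 h2 h3
    have heq := ext_of_generate_finite C hCgen.symm hCpi h1 h3
    rw [heq]
    refine ⟨fun x => ?_⟩
    rw [Measure.map_apply e.2.1.measurable (measurableSet_singleton x)]
    refine (measure_mono_null (t := {(e : Equiv.Perm Ω).symm x}) ?_ (measure_singleton _))
    intro y hy
    rw [mem_singleton_iff, Equiv.eq_symm_apply]
    exact hy
  filter_upwards [e.2.2.quasiMeasurePreserving.ae hmain] with ω hω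
  rwa [Equiv.apply_symm_apply] at hω

end SubSigmaField

end SubSigmaField

/-! ### The space of continuous filtrations -/

section Filtrations

variable {Ω : Type*} [mΩ : MeasurableSpace Ω] [StandardBorelSpace Ω]

/-- The space `X₁` of conditionally nonatomic sub-σ-fields. -/
abbrev CondNonatomicField (P : Measure Ω) [IsFiniteMeasure P] : Type _ :=
  {E : SubSigmaField P // E.IsCondNonatomic}

variable {P : Measure Ω} [IsFiniteMeasure P]

instance : MulAction (Aut P) (CondNonatomicField P) where
  smul g E := ⟨g • E.1, QuotientGroup.induction_on g fun e => E.2.smul e⟩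
  one_smul E := Subtype.ext (one_smul (Aut P) E.1)
  mul_smul g h E := Subtype.ext (mul_smul g h E.1)

instance : ContinuousConstSMul (Aut P) (CondNonatomicField P) where
  continuous_const_smul g := QuotientGroup.induction_on g fun e =>
    ((SubSigmaField.continuous_smul_const e).comp continuous_subtype_val).subtype_mk
      fun E => E.2.smul e

/-- A continuous map `x : T → X₁` is a (continuous) filtration starting from the trivial σ-field if
it is increasing, and its value at the least element of `T` is trivial. -/
structure IsFiltration {T : Set ℝ≥0∞} (x : C(T, CondNonatomicField P)) : Prop where
  mono : ∀ s t : T, s ≤ t → (x s).1.toMeasurableSpace ≤ (x t).1.toMeasurableSpace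
  trivial_of_least : ∀ t : T, (∀ s : T, t ≤ s) → (x t).1.IsTrivial

/-- The space `X_T` of continuous filtrations on `T` that start from the trivial σ-field, with the
topology of `C(T, X₁)`. -/
abbrev FiltrationSpace (P : Measure Ω) [IsFiniteMeasure P] (T : Set ℝ≥0∞) : Type _ :=
  {x : C(T, CondNonatomicField P) // IsFiltration x}

/-- `(g • x) t = g • x t`. -/
noncomputable instance (T : Set ℝ≥0∞) : MulAction (Aut P) (FiltrationSpace P T) where
  smul g x := ⟨g • x.1, QuotientGroup.induction_on g fun e =>
    ⟨fun s t hst _ hA => x.2.mono s t hst _ hA,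
      fun t ht => (x.2.trivial_of_least t ht).smul e⟩⟩
  one_smul x := Subtype.ext (one_smul (Aut P) x.1)
  mul_smul g h x := Subtype.ext (mul_smul g h x.1)

end Filtrations

end ProbSpace

/-! The zero-one law follows from one property of the action: any two filtrations `x`, `y` lie in
the closure of the orbit of a third one, `z` (`exists_mem_closure_orbit`). Suppose that an invariant
set `A` agrees with an open set `U`, and its complement with an open set `V`, up to meager sets. If
`U` or `V` is empty, `A` is meager or comeager. Otherwise some orbit meets both `U` and `V`, so a
group element `k` makes `U ∩ k⁻¹V` a nonempty open set; a generic point of it lies in `A` and is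
moved by `k` outside `A`, a contradiction (`isMeagre_or_mem_residual`).

To find `z`, identify `Ω` with `Ω × Ω`, with coordinate maps `p`, `q`, and let `z t` be generated by
`p⁻¹(x t)` and `q⁻¹(y t)`. By independence, conditional expectation given `z t` acts on functions of
`p` as conditional expectation given `x t` (`proj_join_tensor`), so the distance from `f ∘ p` to
`L₂(z t)` is that from `f` to `L₂(x t)`. The noninvertible map `p` is a strong limit of
automorphisms `e n` (`exists_tendsto_koopPerm`). Since distance functions are nonexpansive, the
distance functions of `e n • z` converge to those of `x` uniformly in `t` (`mem_closure_orbit`). The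
same holds for `q` and `y`.

The remaining work is Polishness. Sub-σ-fields correspond to closed sublattices of `L₂` containing
the constants; a strong limit of conditional expectations is again one, so the space of sub-σ-fields
is closed in a countable power of `L₂` (`isClosedEmbedding_proj`). Conditional nonatomicity is a
`Gδ` condition, expressed by mean squared conditional probabilities of cells
(`isCondNonatomic_iff`), and filtrations form a closed set of continuous maps. The automorphism
group embeds as a closed subset of `L₂ × L₂` through the compositions of an injective coordinate
with an automorphism and with its inverse (`isClosed_range_coordPair`). -/

open Topology
open scoped symmDiff

set_option linter.unusedSectionVars false

namespace ProbSpace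

/-! ### Indicators in `L₂` and closed sublattices -/

section LTwo

variable {Ω : Type*} {m : MeasurableSpace Ω} [mΩ : MeasurableSpace Ω] {P : Measure Ω}
  [IsProbabilityMeasure P]

/-- The indicator of a measurable set, as an element of `L₂`. -/
noncomputable def ind (P : Measure Ω) [IsProbabilityMeasure P] {s : Set Ω} (hs : MeasurableSet s) :
    Lp ℝ 2 P :=
  indicatorConstLp 2 hs (measure_ne_top P s) 1

lemma coeFn_ind {s : Set Ω} (hs : MeasurableSet s) :
    ind P hs =ᵐ[P] s.indicator fun _ => (1 : ℝ) := indicatorConstLp_coeFn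

lemma ind_congr {s t : Set Ω} (hs : MeasurableSet s) (ht : MeasurableSet t) (h : s =ᵐ[P] t) :
    ind P hs = ind P ht :=
  (indicatorConstLp_inj hs _ ht _ one_ne_zero).2 h

lemma norm_ind_sq {s : Set Ω} (hs : MeasurableSet s) : ‖ind P hs‖ ^ 2 = P.real s := by
  rw [ind, norm_indicatorConstLp (by simp) (by simp)]
  simp only [norm_one, one_mul, ENNReal.toReal_ofNat]
  rw [← Real.rpow_natCast, ← Real.rpow_mul measureReal_nonneg]
  norm_num

lemma ind_compl {s : Set Ω} (hs : MeasurableSet s) :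
    ind P hs.compl = ind P MeasurableSet.univ - ind P hs := by
  ext1
  grw [Lp.coeFn_sub, coeFn_ind, coeFn_ind, coeFn_ind]
  refine Eventually.of_forall fun x => ?_
  by_cases h : x ∈ s <;> simp [h]

lemma ind_union {s t : Set Ω} (hs : MeasurableSet s) (ht : MeasurableSet t) :
    ind P (hs.union ht) = ind P hs ⊔ ind P ht := by
  ext1
  filter_upwards [Lp.coeFn_sup (ind P hs) (ind P ht), coeFn_ind (P := P) hs, coeFn_ind (P := P) ht,
    coeFn_ind (P := P) (hs.union ht)] with x h1 h2 h3 h4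
  rw [h1, h4, Pi.sup_apply, h2, h3]
  by_cases hx : x ∈ s <;> by_cases hy : x ∈ t <;> simp [hx, hy]

lemma tendsto_ind {ι : Type*} {l : Filter ι} {s : ι → Set Ω} {t : Set Ω}
    (hs : ∀ i, MeasurableSet (s i)) (ht : MeasurableSet t)
    (h : Tendsto (fun i => P (s i ∆ t)) l (𝓝 0)) :
    Tendsto (fun i => ind P (hs i)) l (𝓝 (ind P ht)) :=
  tendsto_indicatorConstLp_set (by simp) h

lemma tendsto_ind_iUnion {s : ℕ → Set Ω} (hs : ∀ i, MeasurableSet (s i)) (hmono : Monotone s) :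
    Tendsto (fun i => ind P (hs i)) atTop (𝓝 (ind P (MeasurableSet.iUnion hs))) := by
  refine tendsto_ind hs _ ?_
  have h : ∀ i, s i ∆ (⋃ n, s n) = (⋃ n, s n) \ s i := fun i => by
    rw [symmDiff_def, Set.sdiff_eq_empty.2 (subset_iUnion s i)]
    exact bot_sup_eq _
  simp_rw [h]
  have h0 : (⋂ i, ((⋃ n, s n) \ s i)) = ∅ := by
    rw [← Set.sdiff_iUnion, Set.sdiff_self]
  rw [← measure_empty (μ := P), ← h0]
  refine tendsto_measure_iInter_atTop
    (fun i => ((MeasurableSet.iUnion hs).diff (hs i)).nullMeasurableSet)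
    (fun i j hij => Set.sdiff_subset_sdiff_right (hmono hij)) ⟨0, measure_ne_top _ _⟩

/-- Dynkin's π-λ argument: complements and finite disjoint unions are linear operations on
indicators, and countable disjoint unions are `L₂`-limits of the finite ones. -/
lemma ind_mem_of_generateFrom (hm : m ≤ mΩ) {C : Set (Set Ω)}
    (hC : m = MeasurableSpace.generateFrom C) (hpi : IsPiSystem C)
    {K : Submodule ℝ (Lp ℝ 2 P)} (hK : IsClosed (K : Set (Lp ℝ 2 P)))
    (huniv : ind P MeasurableSet.univ ∈ K)
    (h : ∀ s ∈ C, ∀ hs : MeasurableSet s, ind P hs ∈ K) {s : Set Ω} (hs : MeasurableSet[m] s) :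
    ind P (hm s hs) ∈ K := by
  induction s, hs using MeasurableSpace.induction_on_inter hC hpi with
  | empty =>
    have : ind P (MeasurableSet.empty : MeasurableSet (∅ : Set Ω)) = 0 := indicatorConstLp_empty
    exact this ▸ K.zero_mem
  | basic s hs => exact h s hs _
  | compl s hs ih =>
    have h1 : ind P (hm s hs).compl ∈ K := by
      rw [ind_compl (hm s hs)]
      exact K.sub_mem huniv ih
    exact h1
  | iUnion f hdisj hf ih =>
    have hacc : ∀ n, MeasurableSet (⋃ i ∈ Finset.range n, f i) := fun n =>
      Finset.measurableSet_biUnion _ fun i _ => hm _ (hf i)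
    have hmem : ∀ n, ind P (hacc n) ∈ K := by
      intro n
      induction n with
      | zero =>
        have : ind P (hacc 0) = 0 := by
          rw [← indicatorConstLp_empty (p := 2) (μ := P) (c := (1 : ℝ))]
          exact ind_congr _ _ (by simp)
        rw [this]
        exact K.zero_mem
      | succ n ihn =>
        have h1 : ind P (hacc (n + 1)) = ind P ((hacc n).union (hm _ (hf n))) :=
          ind_congr _ _ (by rw [Finset.range_add_one, Finset.set_biUnion_insert, union_comm]; rfl)
        rw [h1, ind, indicatorConstLp_disjoint_union (hacc n) (hm _ (hf n)) (measure_ne_top _ _)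
          (measure_ne_top _ _)]
        · exact K.add_mem ihn (ih n)
        · rw [Set.disjoint_iUnion₂_left]
          intro i hi
          exact hdisj (Finset.mem_range.1 hi).ne
    have hlim := tendsto_ind_iUnion (P := P) hacc (fun a b hab =>
      Set.biUnion_subset_biUnion_left fun i hi =>
        Finset.mem_range.2 (lt_of_lt_of_le (Finset.mem_range.1 hi) hab))
    have heq : ind P (MeasurableSet.iUnion hacc) = ind P (MeasurableSet.iUnion fun i => hm _ (hf i)) := by
      refine ind_congr _ _ (EventuallyEq.of_eq (Set.ext fun x => ?_))
      simp only [mem_iUnion, Finset.mem_range, exists_prop]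
      exact ⟨fun ⟨_, i, _, hx⟩ => ⟨i, hx⟩, fun ⟨i, hx⟩ => ⟨i + 1, i, i.lt_succ_self, hx⟩⟩
    rw [heq] at hlim
    exact hK.mem_of_tendsto hlim (Eventually.of_forall hmem)

/-- A closed subspace of `L₂` containing the indicators of a generating `π`-system contains all
measurable elements. -/
theorem lpMeas_le_of_generateFrom (hm : m ≤ mΩ) {C : Set (Set Ω)}
    (hC : m = MeasurableSpace.generateFrom C) (hpi : IsPiSystem C)
    {K : Submodule ℝ (Lp ℝ 2 P)} (hK : IsClosed (K : Set (Lp ℝ 2 P)))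
    (huniv : ind P MeasurableSet.univ ∈ K)
    (h : ∀ s ∈ C, ∀ hs : MeasurableSet s, ind P hs ∈ K) :
    lpMeas ℝ ℝ m 2 P ≤ K := by
  intro f hf
  refine Lp.induction_stronglyMeasurable hm (by simp) (fun f => f ∈ K) ?_ ?_ ?_ f hf
  · intro c s hs _
    have h1 := ind_mem_of_generateFrom hm hC hpi hK huniv h hs
    have h2 : (Lp.simpleFunc.indicatorConst 2 (hm s hs) (measure_ne_top P s) c : Lp ℝ 2 P) =
        c • ind P (hm s hs) := by
      rw [Lp.simpleFunc.coe_indicatorConst]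
      ext1
      filter_upwards [indicatorConstLp_coeFn (p := 2) (hs := hm s hs)
        (hμs := measure_ne_top P s) (c := c), Lp.coeFn_smul c (ind P (hm s hs)),
        coeFn_ind (P := P) (hm s hs)] with x h1 h2 h3
      rw [h1, h2, Pi.smul_apply, h3]
      by_cases hx : x ∈ s <;> simp [hx]
    rw [h2]
    exact K.smul_mem _ h1
  · intro f g hf hg _ _ _ h1 h2
    exact K.add_mem h1 h2
  · exact hK.preimage continuous_subtype_val

theorem eq_top_of_generateFrom {C : Set (Set Ω)}
    (hC : mΩ = MeasurableSpace.generateFrom C) (hpi : IsPiSystem C)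
    {K : Submodule ℝ (Lp ℝ 2 P)} (hK : IsClosed (K : Set (Lp ℝ 2 P)))
    (huniv : ind P MeasurableSet.univ ∈ K)
    (h : ∀ s ∈ C, ∀ hs : MeasurableSet s, ind P hs ∈ K) : K = ⊤ := by
  rw [eq_top_iff]
  intro f _
  exact lpMeas_le_of_generateFrom le_rfl hC hpi hK huniv h (mem_lpMeas_self P f)

lemma measurable_coeFn (f : Lp ℝ 2 P) : Measurable f := (Lp.stronglyMeasurable f).measurable

/-- The functions `min (n (f - a)⁺) 1` approximate the indicator of `{f > a}`. -/
noncomputable def levelApprox (f : Lp ℝ 2 P) (a : ℝ) (n : ℕ) : Lp ℝ 2 P :=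
  ((n : ℝ) • ((f - a • ind P MeasurableSet.univ) ⊔ 0)) ⊓ ind P MeasurableSet.univ

/-- The error is at most 1 and vanishes off the set where `0 < f - a < 1 / n`; these sets decrease
to the empty set. -/
theorem tendsto_levelApprox (f : Lp ℝ 2 P) (a : ℝ) :
    Tendsto (levelApprox f a) atTop
      (𝓝 (ind P (measurableSet_lt measurable_const (measurable_coeFn f) :
        MeasurableSet {x | a < f x}))) := by
  set hL := (measurableSet_lt measurable_const (measurable_coeFn f) :
        MeasurableSet {x | a < f x})
  set S : ℕ → Set Ω := fun n => {x | 0 < f x - a} ∩ {x | (n : ℝ) * (f x - a) < 1} with hSdef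
  have hS : ∀ n, MeasurableSet (S n) := fun n =>
    (measurableSet_lt measurable_const ((measurable_coeFn f).sub_const a)).inter
      (measurableSet_lt (((measurable_coeFn f).sub_const a).const_mul _) measurable_const)
  have hanti : Antitone S := fun i j hij x hx =>
    by
    have h0 : 0 < f x - a := hx.1
    have h1 : (j : ℝ) * (f x - a) < 1 := hx.2
    have h2 : (i : ℝ) ≤ j := by exact_mod_cast hij
    exact ⟨h0, lt_of_le_of_lt (mul_le_mul_of_nonneg_right h2 h0.le) h1⟩
  have hinter : ⋂ n, S n = ∅ := by
    ext x
    simp only [mem_iInter, mem_empty_iff_false, iff_false, not_forall]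
    by_cases hx : 0 < f x - a
    · obtain ⟨n, hn⟩ := exists_nat_gt (1 / (f x - a))
      refine ⟨n, fun h => ?_⟩
      rw [div_lt_iff₀ hx] at hn
      exact absurd h.2 (not_lt.2 hn.le)
    · exact ⟨0, fun h => hx h.1⟩
  have hlim : Tendsto (fun n => ind P (hS n)) atTop (𝓝 0) := by
    have h0 : ind P (MeasurableSet.empty : MeasurableSet (∅ : Set Ω)) = 0 :=
      indicatorConstLp_empty
    rw [← h0]
    refine tendsto_ind hS _ ?_
    have := tendsto_measure_iInter_atTop (μ := P) (fun n => (hS n).nullMeasurableSet) hanti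
      ⟨0, measure_ne_top _ _⟩
    rw [hinter, measure_empty] at this
    have h1 : ∀ n, S n ∆ ∅ = S n := fun n => symmDiff_bot (S n)
    simpa only [h1, Function.comp_def] using this
  rw [tendsto_iff_norm_sub_tendsto_zero]
  refine squeeze_zero (fun _ => norm_nonneg _) (fun n => ?_) (tendsto_zero_iff_norm_tendsto_zero.1 hlim)
  refine Lp.norm_le_norm_of_ae_le ?_
  filter_upwards [Lp.coeFn_sub (levelApprox f a n) (ind P hL), coeFn_ind (P := P) hL,
    coeFn_ind (P := P) (hS n), coeFn_ind (P := P) (MeasurableSet.univ : MeasurableSet (univ : Set Ω)),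
    Lp.coeFn_inf ((n : ℝ) • ((f - a • ind P MeasurableSet.univ) ⊔ 0)) (ind P MeasurableSet.univ),
    Lp.coeFn_smul (n : ℝ) ((f - a • ind P MeasurableSet.univ) ⊔ 0),
    Lp.coeFn_sup (f - a • ind P MeasurableSet.univ) 0,
    Lp.coeFn_sub f (a • ind P MeasurableSet.univ),
    Lp.coeFn_smul a (ind P (MeasurableSet.univ : MeasurableSet (univ : Set Ω))),
    Lp.coeFn_zero ℝ 2 P] with x h1 h2 h3 h4 h5 h6 h7 h8 h9 h10
  have hv : levelApprox f a n x = min (n * max (f x - a) 0) 1 := by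
    rw [levelApprox, h5, Pi.inf_apply, h6, Pi.smul_apply, h7, Pi.sup_apply, h8, Pi.sub_apply, h9,
      Pi.smul_apply, h4, h10]
    simp
  rw [h1, Pi.sub_apply, hv, h2, h3]
  by_cases hx : a < f x
  · have hx0 : 0 < f x - a := sub_pos.2 hx
    rw [indicator_of_mem (show x ∈ {x | a < f x} from hx), max_eq_left hx0.le]
    by_cases hn : (n : ℝ) * (f x - a) < 1
    · rw [indicator_of_mem (show x ∈ S n from ⟨hx0, hn⟩), min_eq_left hn.le, Real.norm_eq_abs,
        abs_of_nonpos (by linarith), norm_one]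
      have : 0 ≤ (n : ℝ) * (f x - a) := by positivity
      linarith
    · rw [min_eq_right (not_lt.1 hn)]
      simp
  · rw [indicator_of_notMem (show x ∉ {x | a < f x} from hx), max_eq_right (by linarith)]
    simp

lemma sup_mem_of_abs_mem {K : Submodule ℝ (Lp ℝ 2 P)} (habs : ∀ f ∈ K, |f| ∈ K) {f g : Lp ℝ 2 P}
    (hf : f ∈ K) (hg : g ∈ K) : f ⊔ g ∈ K := by
  have h : f ⊔ g = (2 : ℝ)⁻¹ • (f + g + |f - g|) := by
    ext1
    filter_upwards [Lp.coeFn_sup f g, Lp.coeFn_smul (2 : ℝ)⁻¹ (f + g + |f - g|),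
      Lp.coeFn_add (f + g) |f - g|, Lp.coeFn_add f g, Lp.coeFn_abs (f - g),
      Lp.coeFn_sub f g] with x h1 h2 h3 h4 h5 h6
    rw [h1, h2, Pi.smul_apply, h3, Pi.add_apply, h4, h5, h6, Pi.sup_apply, Pi.add_apply,
      Pi.sub_apply, smul_eq_mul]
    rcases le_total (f x) (g x) with h | h
    · rw [sup_eq_right.2 h, abs_of_nonpos (sub_nonpos.2 h)]; ring
    · rw [sup_eq_left.2 h, abs_of_nonneg (sub_nonneg.2 h)]; ring
  rw [h]
  exact K.smul_mem _ (K.add_mem (K.add_mem hf hg) (habs _ (K.sub_mem hf hg)))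

lemma inf_mem_of_abs_mem {K : Submodule ℝ (Lp ℝ 2 P)} (habs : ∀ f ∈ K, |f| ∈ K) {f g : Lp ℝ 2 P}
    (hf : f ∈ K) (hg : g ∈ K) : f ⊓ g ∈ K := by
  have h : f ⊓ g = f + g - f ⊔ g := by
    rw [eq_sub_iff_add_eq]; exact inf_add_sup f g
  rw [h]
  exact K.sub_mem (K.add_mem hf hg) (sup_mem_of_abs_mem habs hf hg)

lemma levelApprox_mem {K : Submodule ℝ (Lp ℝ 2 P)} (habs : ∀ f ∈ K, |f| ∈ K)
    (huniv : ind P MeasurableSet.univ ∈ K) {f : Lp ℝ 2 P} (hf : f ∈ K) (a : ℝ) (n : ℕ) :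
    levelApprox f a n ∈ K :=
  inf_mem_of_abs_mem habs (K.smul_mem _ (sup_mem_of_abs_mem habs
    (K.sub_mem hf (K.smul_mem _ huniv)) K.zero_mem)) huniv

/-- A closed sublattice of `L₂` containing the constants contains the indicators of the level sets
of its elements. -/
theorem ind_level_mem {K : Submodule ℝ (Lp ℝ 2 P)} (hK : IsClosed (K : Set (Lp ℝ 2 P)))
    (habs : ∀ f ∈ K, |f| ∈ K) (huniv : ind P MeasurableSet.univ ∈ K) {f : Lp ℝ 2 P} (hf : f ∈ K)
    (a : ℝ) : ind P (measurableSet_lt measurable_const (measurable_coeFn f) :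
        MeasurableSet {x | a < f x}) ∈ K :=
  hK.mem_of_tendsto (tendsto_levelApprox f a)
    (Eventually.of_forall (levelApprox_mem habs huniv hf a))

end LTwo

/-! ### A bounded real coordinate on a standard Borel space -/

section Coord

variable (Ω : Type*) [mΩ : MeasurableSpace Ω] [StandardBorelSpace Ω]

/-- A measurable embedding of a standard Borel space into the interval `(0, 1)`. -/
noncomputable def coord (ω : Ω) : ℝ := Real.sigmoid (embeddingReal Ω ω)

lemma measurableEmbedding_coord : MeasurableEmbedding (coord Ω) :=
  (continuous_sigmoid.measurableEmbedding Real.sigmoid_injective).comp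
    (measurableEmbedding_embeddingReal Ω)

lemma measurable_coord : Measurable (coord Ω) := (measurableEmbedding_coord Ω).measurable

variable {Ω}

lemma coord_pos (ω : Ω) : 0 < coord Ω ω := Real.sigmoid_pos _
lemma coord_lt_one (ω : Ω) : coord Ω ω < 1 := Real.sigmoid_lt_one _
lemma coord_injective : Function.Injective (coord Ω) := (measurableEmbedding_coord Ω).injective

lemma isPiSystem_coord_Ioi : IsPiSystem (range fun a : ℝ => {ω : Ω | a < coord Ω ω}) := by
  rintro _ ⟨a, rfl⟩ _ ⟨b, rfl⟩ _
  refine ⟨max a b, ?_⟩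
  ext ω
  simp

lemma generateFrom_coord_Ioi :
    mΩ = MeasurableSpace.generateFrom (range fun a : ℝ => {ω : Ω | a < coord Ω ω}) := by
  refine (measurableEmbedding_coord Ω).comap_eq.symm.trans ?_
  rw [BorelSpace.measurable_eq (α := ℝ),
    borel_eq_generateFrom_Ioi, MeasurableSpace.comap_generateFrom, ← range_comp]
  rfl

variable (P : Measure Ω) [IsProbabilityMeasure P]

lemma memLp_coord : MemLp (coord Ω) 2 P :=
  MemLp.of_bound (measurable_coord Ω).aestronglyMeasurable 1 (Eventually.of_forall fun ω => by
    rw [Real.norm_eq_abs, abs_of_pos (coord_pos ω)]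
    exact (coord_lt_one ω).le)

/-- The coordinate as an element of `L₂`. -/
noncomputable def coordLp : Lp ℝ 2 P := (memLp_coord P).toLp

lemma coeFn_coordLp : coordLp P =ᵐ[P] coord Ω := MemLp.coeFn_toLp _

/-- A closed sublattice of `L₂` containing the constants and the coordinate is everything. -/
theorem eq_top_of_coordLp_mem {K : Submodule ℝ (Lp ℝ 2 P)} (hK : IsClosed (K : Set (Lp ℝ 2 P)))
    (habs : ∀ f ∈ K, |f| ∈ K) (huniv : ind P MeasurableSet.univ ∈ K) (h : coordLp P ∈ K) :
    K = ⊤ := by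
  refine eq_top_of_generateFrom generateFrom_coord_Ioi isPiSystem_coord_Ioi hK huniv ?_
  rintro _ ⟨a, rfl⟩ hs
  rw [ind_congr hs (measurableSet_lt measurable_const (measurable_coeFn (coordLp P)))]
  · exact ind_level_mem hK habs huniv h a
  · filter_upwards [coeFn_coordLp P] with ω h
    change (a < _) = (a < _)
    rw [h]

end Coord

/-! ### Isomorphisms of nonatomic standard Borel probability spaces -/

section Isomorphism

variable {Ω Ω' : Type*} [MeasurableSpace Ω] [StandardBorelSpace Ω] [MeasurableSpace Ω']
  [StandardBorelSpace Ω']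

/-- The space is Borel isomorphic to the plane, and only countably many of the disjoint vertical
lines can have positive measure. Such a null set leaves room for repairing a bijection that is
defined almost everywhere. -/
lemma exists_null_not_countable (P : Measure Ω) [IsProbabilityMeasure P] [NullSingletonClass P] :
    ∃ N : Set Ω, MeasurableSet N ∧ P N = 0 ∧ ¬ N.Countable := by
  have hΩ : ¬ Countable Ω := fun h => by
    have := (Set.to_countable (univ : Set Ω)).measure_zero P
    simp at this
  have hR : ¬ Countable (ℝ × ℝ) := fun h => by
    have : Countable ℝ := (Prod.mk_right_injective (0 : ℝ)).countable
    exact Cardinal.not_countable_real (to_countable _)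
  set e : Ω ≃ᵐ ℝ × ℝ := PolishSpace.measurableEquivOfNotCountable hΩ hR
  set A : ℝ → Set Ω := fun x => e ⁻¹' (Prod.fst ⁻¹' {x}) with hA
  have hAm : ∀ x, MeasurableSet (A x) := fun x =>
    e.measurable (measurable_fst (measurableSet_singleton x))
  have hc := Measure.countable_meas_pos_of_disjoint_iUnion (μ := P) hAm (fun x y hxy => by
    refine Set.disjoint_left.2 fun ω h1 h2 => hxy ?_
    have h1' : (e ω).1 = x := h1
    have h2' : (e ω).1 = y := h2
    rw [← h1', h2'])
  obtain ⟨x, hx⟩ : ∃ x, x ∉ {i | 0 < P (A i)} := by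
    by_contra! h
    rw [eq_univ_of_forall h] at hc
    exact Cardinal.not_countable_real hc
  refine ⟨A x, hAm x, by simpa using hx, fun h => ?_⟩
  have h1 : Set.Countable (range fun y : ℝ => e.symm (x, y)) :=
    h.mono (by rintro _ ⟨y, rfl⟩; simp [hA])
  have h2 : Countable ℝ := by
    have hinj : Function.Injective fun y : ℝ => e.symm (x, y) := fun y z h => by
      have := e.symm.injective h
      exact (Prod.mk.inj this).2
    have := h1.to_subtype
    exact (rangeFactorization_injective.2 hinj).countable
  exact Cardinal.not_countable_real (to_countable _)

/-- A measure preserving map that is injective on a conull set is, up to a null set, a measurable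
isomorphism. -/
theorem exists_measurableEquiv_ae_eq {P : Measure Ω} {P' : Measure Ω'} [IsProbabilityMeasure P]
    [NullSingletonClass P] [IsProbabilityMeasure P'] [NullSingletonClass P'] {T : Ω → Ω'}
    (hT : MeasurePreserving T P P') {A : Set Ω} (hA : MeasurableSet A) (hPA : P Aᶜ = 0)
    (hinj : InjOn T A) : ∃ e : Ω ≃ᵐ Ω', MeasurePreserving e P P' ∧ e =ᵐ[P] T := by
  classical
  obtain ⟨N, hNm, hN0, hNc⟩ := exists_null_not_countable P
  obtain ⟨N', hNm', hN0', hNc'⟩ := exists_null_not_countable P'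
  -- Uncountable null sets are discarded on both sides, so the complements of `A₀` and of its image
  -- are uncountable standard Borel spaces, hence isomorphic; any isomorphism between them completes
  -- `T`.
  set A₀ : Set Ω := A \ (N ∪ T ⁻¹' N') with hA₀
  have hA₀m : MeasurableSet A₀ := hA.diff (hNm.union (hT.measurable hNm'))
  have hA₀null : P A₀ᶜ = 0 := by
    have : A₀ᶜ ⊆ Aᶜ ∪ (N ∪ T ⁻¹' N') := fun x hx => by
      simp only [hA₀, mem_compl_iff, Set.mem_sdiff, not_and, not_not] at hx
      by_cases h : x ∈ A
      · exact Or.inr (hx h)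
      · exact Or.inl h
    refine measure_mono_null this (measure_union_null hPA (measure_union_null hN0 ?_))
    rw [hT.measure_preimage hNm'.nullMeasurableSet, hN0']
  have hinj₀ : Function.Injective (A₀.domRestrict T) :=
    injOn_iff_injective.1 (hinj.mono Set.sdiff_subset)
  have := hA₀m.standardBorel
  have hemb : MeasurableEmbedding (A₀.domRestrict T) :=
    (hT.measurable.comp measurable_subtype_coe).measurableEmbedding hinj₀
  set B₀ := range (A₀.domRestrict T) with hB₀
  have hB₀m : MeasurableSet B₀ := hemb.measurableSet_range
  have hcA : ¬ Countable ↥(A₀ᶜ) := fun h => hNc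
    ((countable_coe_iff.1 h).mono fun x hx (hx' : x ∈ A₀) => hx'.2 (Or.inl hx))
  have hcB : ¬ Countable ↥(B₀ᶜ) := fun h => hNc'
    ((countable_coe_iff.1 h).mono (by
      rintro x hx ⟨⟨y, hy⟩, rfl⟩
      exact hy.2 (Or.inr hx)))
  have := hA₀m.compl.standardBorel
  have := hB₀m.compl.standardBorel
  set e : Ω ≃ᵐ Ω' := (MeasurableEquiv.sumCompl hA₀m).symm.trans
    ((MeasurableEquiv.sumCongr hemb.equivRange
      (PolishSpace.measurableEquivOfNotCountable hcA hcB)).trans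
      (MeasurableEquiv.sumCompl hB₀m)) with he
  have heT : ∀ ω ∈ A₀, e ω = T ω := fun ω hω => by
    have h1 : (MeasurableEquiv.sumCompl hA₀m).symm ω = Sum.inl ⟨ω, hω⟩ := by
      rw [MeasurableEquiv.symm_apply_eq]
      rfl
    rw [he, MeasurableEquiv.trans_apply, MeasurableEquiv.trans_apply, h1]
    change ((hemb.equivRange ⟨ω, hω⟩ : B₀) : Ω') = T ω
    rw [hemb.equivRange_apply]
    rfl
  have hae : e =ᵐ[P] T := by
    have : ∀ᵐ ω ∂P, ω ∈ A₀ := hA₀null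
    filter_upwards [this] with ω hω using heT ω hω
  exact ⟨e, ⟨e.measurable, by rw [Measure.map_congr hae, hT.map_eq]⟩, hae⟩

lemma continuous_cdf (μ : Measure ℝ) [IsProbabilityMeasure μ] [NullSingletonClass μ] :
    Continuous (cdf μ) := by
  rw [continuous_iff_continuousAt]
  intro x
  rw [(cdf μ).mono.continuousAt_iff_leftLim_eq_rightLim, (cdf μ).rightLim_eq]
  refine le_antisymm ((cdf μ).mono.leftLim_le le_rfl) ?_
  have h := (cdf μ).measure_singleton x
  rw [measure_cdf, measure_singleton, eq_comm, ENNReal.ofReal_eq_zero] at h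
  linarith

/-- The sublevel set is a half-line ending at its supremum `s`, and continuity forces the
distribution function to equal `u` at `s`. It can be empty only for `u = 0`, and `u < 1` keeps it
bounded above. -/
lemma measure_cdf_le (μ : Measure ℝ) [IsProbabilityMeasure μ] [NullSingletonClass μ] {u : ℝ}
    (h0 : 0 ≤ u) (h1 : u < 1) : μ {x | cdf μ x ≤ u} = ENNReal.ofReal u := by
  have hcont := continuous_cdf μ
  rcases eq_empty_or_nonempty {x | cdf μ x ≤ u} with hemp | hne
  · rw [hemp, measure_empty]
    rcases h0.eq_or_lt with h | h
    · simp [← h]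
    · obtain ⟨x, hx⟩ := ((tendsto_cdf_atBot μ).eventually_lt_const h).exists
      exact absurd (show x ∈ {x | cdf μ x ≤ u} from hx.le) (by simp [hemp])
  · obtain ⟨b, hb⟩ := ((tendsto_cdf_atTop μ).eventually_const_lt h1).exists
    have hbdd : BddAbove {x | cdf μ x ≤ u} := ⟨b, fun x hx => by
      by_contra! h
      exact absurd (hb.trans_le (((cdf μ).mono h.le).trans hx)) (lt_irrefl _)⟩
    have hcl : IsClosed {x | cdf μ x ≤ u} := isClosed_le hcont continuous_const
    set s := sSup {x | cdf μ x ≤ u} with hs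
    have hmem : cdf μ s ≤ u := hcl.csSup_mem hne hbdd
    have hset : {x | cdf μ x ≤ u} = Iic s := by
      ext x
      exact ⟨fun hx => le_csSup hbdd hx, fun hx => ((cdf μ).mono hx).trans hmem⟩
    have hval : cdf μ s = u := by
      refine le_antisymm hmem ?_
      refine ge_of_tendsto ((hcont.tendsto s).mono_left nhdsWithin_le_nhds :
        Tendsto (cdf μ) (𝓝[>] s) (𝓝 (cdf μ s))) ?_
      filter_upwards [self_mem_nhdsWithin] with y hy
      by_contra! h
      exact absurd (le_csSup hbdd (show y ∈ {x | cdf μ x ≤ u} from h.le)) (not_le.2 hy)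
    rw [hset, ← ofReal_cdf, hval]

/-- The uniform distribution on the unit interval. -/
noncomputable abbrev uniform : Measure ℝ := volume.restrict (Ioc 0 1)

instance : IsProbabilityMeasure uniform := ⟨by simp⟩

lemma map_cdf (μ : Measure ℝ) [IsProbabilityMeasure μ] [NullSingletonClass μ] :
    μ.map (cdf μ) = uniform := by
  have hcont := continuous_cdf μ
  have : IsProbabilityMeasure (μ.map (cdf μ)) :=
    Measure.isProbabilityMeasure_map hcont.measurable.aemeasurable
  refine Measure.ext_of_Iic _ _ fun u => ?_
  rw [Measure.map_apply hcont.measurable measurableSet_Iic,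
    Measure.restrict_apply measurableSet_Iic]
  change μ {x | cdf μ x ≤ u} = _
  rcases lt_or_ge u 0 with h | h
  · have e1 : {x | cdf μ x ≤ u} = ∅ := by
      ext x
      simpa using h.trans_le (cdf_nonneg μ x)
    have e2 : Iic u ∩ Ioc 0 1 = ∅ := by
      ext x
      simp only [mem_inter_iff, mem_Iic, mem_Ioc, mem_empty_iff_false, iff_false]
      intro hx
      linarith [hx.1, hx.2.1]
    rw [e1, e2, measure_empty, measure_empty]
  rcases lt_or_ge u 1 with h' | h'
  · have e2 : Iic u ∩ Ioc 0 1 = Ioc 0 u := by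
      ext x
      simp only [mem_inter_iff, mem_Iic, mem_Ioc]
      exact ⟨fun hx => ⟨hx.2.1, hx.1⟩, fun hx => ⟨hx.2, hx.1, by linarith [hx.2]⟩⟩
    rw [measure_cdf_le μ h h', e2, Real.volume_Ioc, sub_zero]
  · have e1 : {x | cdf μ x ≤ u} = univ := by
      ext x
      simpa using (cdf_le_one μ x).trans h'
    have e2 : Iic u ∩ Ioc (0 : ℝ) 1 = Ioc 0 1 := by
      ext x
      simp only [mem_inter_iff, mem_Iic, mem_Ioc]
      exact ⟨fun hx => hx.2, fun hx => ⟨by linarith [hx.2], hx⟩⟩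
    rw [e1, e2, measure_univ, Real.volume_Ioc]
    simp

/-- The distribution function of a measurable embedding is, up to a null set, an isomorphism onto
the unit interval. -/
lemma exists_measurableEquiv_uniform {P : Measure Ω} [IsProbabilityMeasure P]
    [NullSingletonClass P] {ξ : Ω → ℝ} (hξ : MeasurableEmbedding ξ) :
    ∃ e : Ω ≃ᵐ ℝ, MeasurePreserving e P uniform ∧
      ∀ᵐ ω ∂P, e ω = cdf (P.map ξ) (ξ ω) := by
  have : IsProbabilityMeasure (P.map ξ) :=
    Measure.isProbabilityMeasure_map hξ.measurable.aemeasurable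
  have : NullSingletonClass (P.map ξ) := ⟨fun x => by
    rw [Measure.map_apply hξ.measurable (measurableSet_singleton x)]
    exact (subsingleton_singleton.preimage hξ.injective).measure_zero P⟩
  set μ := P.map ξ with hμ
  set F := cdf μ
  have hFm : Measurable F := (continuous_cdf μ).measurable
  have hmp : MeasurePreserving (fun ω => F (ξ ω)) P uniform :=
    ⟨hFm.comp hξ.measurable, by
      rw [← map_cdf μ, hμ, Measure.map_map hFm hξ.measurable]
      rfl⟩
  -- A nontrivial interval of constancy of `F` contains a rational, so avoiding the countably many
  -- values at rationals makes `F ∘ ξ` injective. These values form a null set for the uniform law.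
  set A : Set Ω := {ω | ∀ q : ℚ, F (ξ ω) ≠ F q} with hA
  have hAm : MeasurableSet A := by
    have : A = ⋂ q : ℚ, {ω | F (ξ ω) = F q}ᶜ := by
      ext ω
      simp [hA]
    rw [this]
    exact MeasurableSet.iInter fun q =>
      (measurableSet_eq_fun hmp.measurable measurable_const).compl
  have hA0 : P Aᶜ = 0 := by
    have : Aᶜ = ⋃ q : ℚ, (fun ω => F (ξ ω)) ⁻¹' {F q} := by
      ext ω
      simp [hA]
    rw [this, measure_iUnion_null_iff]
    intro q
    rw [hmp.measure_preimage (measurableSet_singleton _).nullMeasurableSet, measure_singleton]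
  have hlt : ∀ ω ∈ A, ∀ ω' ∈ A, ξ ω < ξ ω' → F (ξ ω) < F (ξ ω') := fun ω hω ω' _ h => by
    obtain ⟨q, hq1, hq2⟩ := exists_rat_btwn h
    exact lt_of_lt_of_le (lt_of_le_of_ne (F.mono hq1.le) (hω q)) (F.mono hq2.le)
  have hinj : InjOn (fun ω => F (ξ ω)) A := fun ω hω ω' hω' h => by
    rcases lt_trichotomy (ξ ω) (ξ ω') with h1 | h1 | h1
    · exact absurd h (hlt ω hω ω' hω' h1).ne
    · exact hξ.injective h1
    · exact absurd h (hlt ω' hω' ω hω h1).ne'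
  obtain ⟨e, he, hae⟩ := exists_measurableEquiv_ae_eq hmp hAm hA0 hinj
  exact ⟨e, he, hae⟩

/-- The embedding `κ + coord` has integer part `κ`, so its distribution function carries the points
labelled `i` into the interval between the probabilities of the labels below `i` and below `i + 1`.
-/
lemma exists_measurableEquiv_uniform_labelled {P : Measure Ω} [IsProbabilityMeasure P]
    [NullSingletonClass P] {κ : Ω → ℕ} (hκ : Measurable κ) :
    ∃ e : Ω ≃ᵐ ℝ, MeasurePreserving e P uniform ∧
      ∀ᵐ ω ∂P, e ω ∈ Ioo ((P.map κ).real (Iio (κ ω))) ((P.map κ).real (Iio (κ ω + 1))) := by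
  set ξ : Ω → ℝ := fun ω => κ ω + coord Ω ω with hξ
  have hfloor : ∀ ω, ⌊ξ ω⌋₊ = κ ω := fun ω => by
    rw [hξ, Nat.floor_eq_iff (add_nonneg (Nat.cast_nonneg _) (coord_pos ω).le)]
    exact ⟨by linarith [coord_pos ω], by linarith [coord_lt_one ω]⟩
  have hemb : MeasurableEmbedding ξ := by
    refine Measurable.measurableEmbedding
      ((measurable_from_top.comp hκ).add (measurable_coord Ω)) fun ω ω' h => ?_
    have h1 : κ ω = κ ω' := by rw [← hfloor, ← hfloor, h]
    have h2 : (κ ω : ℝ) + coord Ω ω = κ ω' + coord Ω ω' := h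
    rw [h1] at h2
    exact coord_injective (add_left_cancel h2)
  have : IsProbabilityMeasure (P.map ξ) :=
    Measure.isProbabilityMeasure_map hemb.measurable.aemeasurable
  set c : ℕ → ℝ := fun i => (P.map κ).real (Iio i) with hc
  have hFi : ∀ i : ℕ, cdf (P.map ξ) i = c i := fun i => by
    rw [cdf_eq_real, map_measureReal_apply hemb.measurable measurableSet_Iic, hc]
    simp only
    rw [map_measureReal_apply hκ measurableSet_Iio]
    congr 1
    ext ω
    simp only [mem_preimage, mem_Iic, mem_Iio, hξ]
    constructor
    · intro h
      have : (κ ω : ℝ) < i := by linarith [coord_pos ω]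
      exact_mod_cast this
    · intro h
      have : (κ ω : ℝ) + 1 ≤ i := by exact_mod_cast h
      linarith [coord_lt_one ω]
  obtain ⟨e, he, hae⟩ := exists_measurableEquiv_uniform (P := P) hemb
  refine ⟨e, he, ?_⟩
  -- The endpoints are countably many, hence negligible; excluding them makes the intervals of
  -- different labels disjoint.
  have hne : ∀ᵐ ω ∂P, e ω ∉ range c := by
    have h0 : uniform (range c) = 0 := (countable_range c).measure_zero _
    exact he.quasiMeasurePreserving.ae (measure_eq_zero_iff_ae_notMem.1 h0)
  filter_upwards [hae, hne] with ω h1 h2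
  have h3 : c (κ ω) ≤ e ω := by
    rw [h1, ← hFi]
    exact (cdf (P.map ξ)).mono (by simp only [hξ]; linarith [coord_pos ω])
  have h4 : e ω ≤ c (κ ω + 1) := by
    rw [h1, ← hFi]
    exact (cdf (P.map ξ)).mono (by simp only [hξ]; push_cast; linarith [coord_lt_one ω])
  exact ⟨lt_of_le_of_ne h3 fun h => h2 ⟨_, h⟩, lt_of_le_of_ne h4 fun h => h2 ⟨_, h.symm⟩⟩

/-- Two nonatomic standard Borel probability spaces are isomorphic, by an isomorphism that respects
given labellings with the same distribution. -/
theorem exists_measurableEquiv_labelled {P : Measure Ω} {P' : Measure Ω'} [IsProbabilityMeasure P]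
    [NullSingletonClass P] [IsProbabilityMeasure P'] [NullSingletonClass P'] {κ : Ω → ℕ}
    {κ' : Ω' → ℕ} (hκ : Measurable κ) (hκ' : Measurable κ') (h : P.map κ = P'.map κ') :
    ∃ e : Ω ≃ᵐ Ω', MeasurePreserving e P P' ∧ ∀ᵐ ω ∂P, κ' (e ω) = κ ω := by
  obtain ⟨e₁, he₁, h₁⟩ := exists_measurableEquiv_uniform_labelled (P := P) hκ
  obtain ⟨e₂, he₂, h₂⟩ := exists_measurableEquiv_uniform_labelled (P := P') hκ'
  have hmp : MeasurePreserving (e₁.trans e₂.symm) P P' := (he₂.symm e₂).comp he₁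
  refine ⟨e₁.trans e₂.symm, hmp, ?_⟩
  filter_upwards [h₁, hmp.quasiMeasurePreserving.ae h₂] with ω a b
  rw [MeasurableEquiv.trans_apply, MeasurableEquiv.apply_symm_apply, ← h] at b
  rw [MeasurableEquiv.trans_apply]
  have : IsFiniteMeasure (P.map κ) := inferInstance
  have hmono : ∀ {i j : ℕ}, i ≤ j → (P.map κ).real (Iio i) ≤ (P.map κ).real (Iio j) :=
    fun hij => measureReal_mono (Iio_subset_Iio hij)
  -- Equal label distributions give the same open intervals on both sides; `e₁ ω` cannot lie in two
  -- intervals with different labels.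
  rcases lt_trichotomy (κ' (e₂.symm (e₁ ω))) (κ ω) with hlt | heq | hlt
  · exact absurd ((b.2.trans_le (hmono hlt)).trans a.1) (lt_irrefl _)
  · exact heq
  · exact absurd ((a.2.trans_le (hmono hlt)).trans b.1) (lt_irrefl _)

end Isomorphism

/-! ### Pointwise convergence of nonexpansive maps -/

section Nonexpansive

variable {ι α β : Type*} [PseudoMetricSpace α] [PseudoMetricSpace β] {l : Filter ι}

/-- An `ε / 3` argument. It reduces strong convergence of projections, distances and composition
operators to a dense set or to generators of a closed subspace. -/
lemma isClosed_setOf_tendsto {Φ : ι → α → β} {Φ₀ : α → β} (hΦ : ∀ i, LipschitzWith 1 (Φ i))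
    (hΦ₀ : LipschitzWith 1 Φ₀) : IsClosed {x | Tendsto (fun i => Φ i x) l (𝓝 (Φ₀ x))} := by
  refine isClosed_of_closure_subset fun x hx => Metric.tendsto_nhds.2 fun ε hε => ?_
  obtain ⟨y, hy, hxy⟩ := Metric.mem_closure_iff.1 hx (ε / 3) (by positivity)
  filter_upwards [Metric.tendsto_nhds.1 hy (ε / 3) (by positivity)] with i hi
  have h1 := (hΦ i).dist_le_mul x y
  have h2 := hΦ₀.dist_le_mul y x
  have h3 := dist_triangle4 (Φ i x) (Φ i y) (Φ₀ y) (Φ₀ x)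
  rw [dist_comm y x] at h2
  simp only [NNReal.coe_one, one_mul] at h1 h2
  linarith

lemma isClosed_setOf_exists_tendsto [CompleteSpace β] [NeBot l] {Φ : ι → α → β}
    (hΦ : ∀ i, LipschitzWith 1 (Φ i)) :
    IsClosed {x | ∃ y, Tendsto (fun i => Φ i x) l (𝓝 y)} := by
  simp_rw [← cauchy_map_iff_exists_tendsto]
  refine isClosed_of_closure_subset fun x hx => Metric.cauchy_iff.2 ⟨inferInstance, fun ε hε => ?_⟩
  obtain ⟨y, hy, hxy⟩ := Metric.mem_closure_iff.1 hx (ε / 3) (by positivity)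
  obtain ⟨t, ht, htε⟩ := (Metric.cauchy_iff.1 hy).2 (ε / 3) (by positivity)
  refine ⟨(fun i => Φ i x) '' {i | Φ i y ∈ t}, image_mem_map ht, ?_⟩
  rintro _ ⟨i, hi, rfl⟩ _ ⟨j, hj, rfl⟩
  have h1 := (hΦ i).dist_le_mul x y
  have h2 := (hΦ j).dist_le_mul y x
  have h3 := dist_triangle4 (Φ i x) (Φ i y) (Φ j y) (Φ j x)
  have h4 := htε _ hi _ hj
  rw [dist_comm y x] at h2
  simp only [NNReal.coe_one, one_mul] at h1 h2
  linarith

end Nonexpansive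

/-! ### The Polish space of sub-σ-fields -/

namespace SubSigmaField

variable {Ω : Type*} {m m' : MeasurableSpace Ω} [mΩ : MeasurableSpace Ω] {P : Measure Ω}

/-- The closed subspace `L₂(E)`. -/
noncomputable abbrev space (E : SubSigmaField P) : Submodule ℝ (Lp ℝ 2 P) :=
  lpMeas ℝ ℝ E.toMeasurableSpace 2 P

instance (E : SubSigmaField P) : E.space.HasOrthogonalProjection :=
  haveI : Fact (E.toMeasurableSpace ≤ mΩ) := ⟨E.le⟩
  inferInstance

lemma isClosed_space (E : SubSigmaField P) : IsClosed (E.space : Set (Lp ℝ 2 P)) :=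
  isClosed_aestronglyMeasurable E.le

/-- The conditional expectation operator on `L₂`. -/
noncomputable abbrev proj (E : SubSigmaField P) : Lp ℝ 2 P →L[ℝ] Lp ℝ 2 P := E.space.starProjection

lemma proj_mem (E : SubSigmaField P) (f : Lp ℝ 2 P) : E.proj f ∈ E.space :=
  Submodule.starProjection_apply_mem _ _

lemma proj_eq_self {E : SubSigmaField P} {f : Lp ℝ 2 P} : E.proj f = f ↔ f ∈ E.space :=
  Submodule.starProjection_eq_self_iff

lemma norm_proj_le (E : SubSigmaField P) (f : Lp ℝ 2 P) : ‖E.proj f‖ ≤ ‖f‖ :=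
  Submodule.norm_starProjection_apply_le _ _

lemma lipschitzWith_proj (E : SubSigmaField P) : LipschitzWith 1 E.proj :=
  LipschitzWith.of_dist_le_mul fun f g => by
    rw [dist_eq_norm, dist_eq_norm, ← map_sub, NNReal.coe_one, one_mul]
    exact E.norm_proj_le _

/-- The distance to `L₂(E)`. -/
noncomputable def defect (E : SubSigmaField P) (f : Lp ℝ 2 P) : ℝ := ‖f - E.proj f‖

lemma defect_le (E : SubSigmaField P) (f : Lp ℝ 2 P) {g : Lp ℝ 2 P} (hg : g ∈ E.space) :
    E.defect f ≤ ‖f - g‖ := by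
  rw [defect, Submodule.starProjection_minimal]
  exact ciInf_le ⟨0, by rintro _ ⟨x, rfl⟩; exact norm_nonneg _⟩ (⟨g, hg⟩ : E.space)

lemma defect_nonneg (E : SubSigmaField P) (f : Lp ℝ 2 P) : 0 ≤ E.defect f := norm_nonneg _

lemma defect_le_norm (E : SubSigmaField P) (f : Lp ℝ 2 P) : E.defect f ≤ ‖f‖ := by
  simpa using E.defect_le f E.space.zero_mem

lemma defect_eq_zero {E : SubSigmaField P} {f : Lp ℝ 2 P} : E.defect f = 0 ↔ f ∈ E.space := by
  rw [defect, norm_eq_zero, sub_eq_zero, eq_comm, proj_eq_self]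

lemma defect_smul (E : SubSigmaField P) (c : ℝ) (f : Lp ℝ 2 P) :
    E.defect (c • f) = |c| * E.defect f := by
  rw [defect, map_smul, ← smul_sub, norm_smul, Real.norm_eq_abs, defect]

lemma lipschitzWith_defect (E : SubSigmaField P) : LipschitzWith 1 E.defect :=
  LipschitzWith.of_le_add fun f g => by
    have h := E.defect_le f (E.proj_mem g)
    have h2 := norm_sub_le_norm_sub_add_norm_sub f g (E.proj g)
    rw [← dist_eq_norm f g] at h2
    unfold defect at *
    linarith

lemma norm_sq_eq (E : SubSigmaField P) (f : Lp ℝ 2 P) :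
    ‖f‖ ^ 2 = ‖E.proj f‖ ^ 2 + E.defect f ^ 2 := by
  have h := E.space.norm_sq_eq_add_norm_sq_starProjection f
  rw [h, Submodule.starProjection_orthogonal']
  rfl

lemma infEDist_toClosedSubspace (E : SubSigmaField P) (f : Lp ℝ 2 P) :
    Metric.infEDist f (E.toClosedSubspace : Set (Lp ℝ 2 P)) = ENNReal.ofReal (E.defect f) := by
  refine le_antisymm ?_ ?_
  · refine (Metric.infEDist_le_edist_of_mem (y := E.proj f) (E.proj_mem f)).trans ?_
    rw [edist_dist, dist_eq_norm, defect]
  · refine Metric.le_infEDist.2 fun g hg => ?_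
    rw [edist_dist, dist_eq_norm]
    exact ENNReal.ofReal_le_ofReal (E.defect_le f hg)

lemma isInducing_min_defect :
    IsInducing fun (E : SubSigmaField P) (f : Lp ℝ 2 P) =>
      min 1 (ENNReal.ofReal (E.defect f)) := by
  refine ⟨?_⟩
  have : (fun (E : SubSigmaField P) (f : Lp ℝ 2 P) => min 1 (ENNReal.ofReal (E.defect f))) =
      (fun (F : TopologicalSpace.Closeds (Lp ℝ 2 P)) (x : Lp ℝ 2 P) =>
          min 1 (Metric.infEDist x (F : Set (Lp ℝ 2 P)))) ∘ toClosedSubspace := by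
    ext E f
    simp only [Function.comp_apply, infEDist_toClosedSubspace]
  rw [this, ← induced_compose]
  rfl

/-- Distances to a subspace are homogeneous and bounded by the norm, so scaling `f` below norm 1
makes the truncation at 1 harmless. -/
lemma continuous_defect (f : Lp ℝ 2 P) : Continuous fun E : SubSigmaField P => E.defect f := by
  set c : ℝ := (‖f‖ + 1)⁻¹ with hc
  have hc0 : 0 < c := by positivity
  have hle : ∀ E : SubSigmaField P, E.defect (c • f) ≤ 1 := fun E => by
    refine (E.defect_le_norm _).trans ?_
    rw [norm_smul, Real.norm_eq_abs, abs_of_pos hc0, hc, inv_mul_le_iff₀ (by positivity)]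
    linarith
  have h : ∀ E : SubSigmaField P,
      E.defect f = c⁻¹ * (min 1 (ENNReal.ofReal (E.defect (c • f)))).toReal := fun E => by
    rw [min_eq_right (by simpa using ENNReal.ofReal_le_ofReal (hle E)),
      ENNReal.toReal_ofReal (E.defect_nonneg _), defect_smul, abs_of_pos hc0,
      inv_mul_cancel_left₀ hc0.ne']
  simp_rw [h]
  refine continuous_const.mul ?_
  refine ENNReal.continuousOn_toReal.comp_continuous
    ((continuous_pi_iff.1 isInducing_min_defect.continuous) (c • f)) fun E => ?_
  exact ((min_le_left _ _).trans_lt ENNReal.one_lt_top).ne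

/-- The topology of sub-σ-fields is that of pointwise convergence of the distance functions. -/
lemma isInducing_defect : IsInducing (defect : SubSigmaField P → Lp ℝ 2 P → ℝ) := by
  refine IsInducing.of_comp (g := fun (u : Lp ℝ 2 P → ℝ) f => min 1 (ENNReal.ofReal (u f)))
    (continuous_pi_iff.2 continuous_defect) ?_ isInducing_min_defect
  exact continuous_pi fun f =>
    continuous_const.min (ENNReal.continuous_ofReal.comp (continuous_apply f))

/-- Split `f = g + h` into its projection given `E₀` and the orthogonal part. Then `E.proj g` stays
near `g` because the distance from `g` to `L₂(E)` is small, and by Pythagoras `E.proj h` is small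
because the distance from `h` is close to its norm. -/
lemma continuous_proj (f : Lp ℝ 2 P) : Continuous fun E : SubSigmaField P => E.proj f := by
  rw [continuous_iff_continuousAt]
  intro E₀
  set g := E₀.proj f with hg
  set h := f - g with hh
  have hg0 : E₀.defect g = 0 := defect_eq_zero.2 (E₀.proj_mem f)
  have hproj : E₀.proj h = 0 := by
    rw [hh, map_sub, proj_eq_self.2 (E₀.proj_mem f), sub_self]
  have hle : ∀ E : SubSigmaField P, dist (E.proj f) g ≤
      E.defect g + √(‖h‖ ^ 2 - E.defect h ^ 2) := fun E => by
    have h1 : ‖E.proj h‖ = √(‖h‖ ^ 2 - E.defect h ^ 2) := by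
      rw [E.norm_sq_eq h, add_sub_cancel_right, Real.sqrt_sq (norm_nonneg _)]
    have h2 : E.proj f - g = -(g - E.proj g) + E.proj h := by
      rw [hh, map_sub]
      abel
    rw [dist_eq_norm, h2, ← h1]
    refine (norm_add_le _ _).trans ?_
    rw [norm_neg]
    rfl
  have hlim : Tendsto (fun E : SubSigmaField P =>
      E.defect g + √(‖h‖ ^ 2 - E.defect h ^ 2)) (𝓝 E₀) (𝓝 0) := by
    have hc : Continuous fun E : SubSigmaField P =>
        E.defect g + √(‖h‖ ^ 2 - E.defect h ^ 2) :=
      (continuous_defect g).add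
        (Real.continuous_sqrt.comp (continuous_const.sub ((continuous_defect h).pow 2)))
    have h0 : E₀.defect g + √(‖h‖ ^ 2 - E₀.defect h ^ 2) = 0 := by
      rw [hg0, E₀.norm_sq_eq h, hproj]
      simp
    rw [← h0]
    exact hc.tendsto E₀
  exact tendsto_iff_dist_tendsto_zero.2 (squeeze_zero (fun _ => dist_nonneg) hle hlim)

/-- Convergence of the conditional expectations of the elements of a dense sequence suffices. -/
lemma isInducing_proj {d : ℕ → Lp ℝ 2 P} (hd : DenseRange d) :
    IsInducing fun (E : SubSigmaField P) n => E.proj (d n) := by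
  rw [isInducing_iff_nhds]
  intro E
  refine le_antisymm
    ((continuous_pi fun n => continuous_proj (d n)).tendsto E).le_comap ?_
  -- It remains to see that the distance functions converge along the pulled-back filter; being
  -- nonexpansive, they need be tested on the dense sequence only.
  rw [← tendsto_id', isInducing_defect.tendsto_nhds_iff, tendsto_pi_nhds]
  have hcl := isClosed_setOf_tendsto
    (l := comap (fun (E : SubSigmaField P) n => E.proj (d n)) (𝓝 fun n => E.proj (d n)))
    (Φ := fun (F : SubSigmaField P) => F.defect) (fun F => F.lipschitzWith_defect)
    E.lipschitzWith_defect
  intro f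
  refine hcl.closure_subset_iff.2 ?_ (hd f)
  rintro _ ⟨n, rfl⟩
  have h : Tendsto (fun (E : SubSigmaField P) n => E.proj (d n))
      (comap (fun (E : SubSigmaField P) n => E.proj (d n)) (𝓝 fun n => E.proj (d n)))
      (𝓝 fun n => E.proj (d n)) := tendsto_comap
  exact (tendsto_const_nhds.sub (tendsto_pi_nhds.1 h n)).norm

/-! ### Sub-σ-fields as closed sublattices of `L₂` -/

section

variable [IsProbabilityMeasure P]

/-- A measurable representative equals 1 on a set of `E` that differs from `s` by a null set, and
null sets belong to `E`. -/
lemma ind_mem_space {E : SubSigmaField P} {s : Set Ω} (hs : MeasurableSet s) :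
    ind P hs ∈ E.space ↔ MeasurableSet[E.toMeasurableSpace] s := by
  constructor
  · rintro ⟨g, hg, hgs⟩
    have h1 : MeasurableSet[E.toMeasurableSpace] {x | g x = 1} :=
      hg.measurable (measurableSet_singleton 1)
    refine E.measurableSet_congr (E.le _ h1) hs ?_ h1
    filter_upwards [hgs, coeFn_ind (P := P) hs] with x h2 h3
    change (g x = 1) = (x ∈ s)
    rw [← h2, h3]
    by_cases hx : x ∈ s <;> simp [hx]
  · intro h
    exact mem_lpMeas_indicatorConstLp E.le h _

lemma ind_univ_mem_space (E : SubSigmaField P) : ind P MeasurableSet.univ ∈ E.space :=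
  (ind_mem_space _).2 MeasurableSet.univ

lemma le_of_space_le {E F : SubSigmaField P} (h : E.space ≤ F.space) :
    E.toMeasurableSpace ≤ F.toMeasurableSpace := fun s hs =>
  (ind_mem_space (E.le s hs)).1 (h ((ind_mem_space _).2 hs))

lemma space_mono {E F : SubSigmaField P} (h : E.toMeasurableSpace ≤ F.toMeasurableSpace) :
    E.space ≤ F.space := fun _ hf => AEStronglyMeasurable.mono h hf

lemma space_injective {E F : SubSigmaField P} (h : E.space = F.space) : E = F :=
  SubSigmaField.ext (le_antisymm (le_of_space_le h.le) (le_of_space_le h.ge))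

/-- Expressing inclusion by inequalities between continuous functions of the fields shows that it is
a closed relation. -/
lemma le_iff_defect_le {E F : SubSigmaField P} :
    E.toMeasurableSpace ≤ F.toMeasurableSpace ↔ ∀ f, F.defect f ≤ E.defect f := by
  constructor
  · exact fun h f => F.defect_le f (space_mono h (E.proj_mem f))
  · intro h
    refine le_of_space_le fun f hf => defect_eq_zero.1 (le_antisymm ?_ (F.defect_nonneg f))
    rw [← defect_eq_zero.2 hf]
    exact h f

lemma abs_mem_space {E : SubSigmaField P} {f : Lp ℝ 2 P} (hf : f ∈ E.space) : |f| ∈ E.space := by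
  obtain ⟨g, hg, hfg⟩ := hf
  refine ⟨fun x => |g x|, continuous_abs.comp_stronglyMeasurable hg, ?_⟩
  filter_upwards [hfg, Lp.coeFn_abs f] with x h1 h2
  rw [h2, h1]

lemma ind_iUnion_mem {K : Submodule ℝ (Lp ℝ 2 P)} (hK : IsClosed (K : Set (Lp ℝ 2 P)))
    (habs : ∀ f ∈ K, |f| ∈ K) {s : ℕ → Set Ω} (hs : ∀ n, MeasurableSet (s n))
    (h : ∀ n, ind P (hs n) ∈ K) : ind P (MeasurableSet.iUnion hs) ∈ K := by
  have hacc : ∀ n, MeasurableSet (accumulate s n) := fun n =>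
    MeasurableSet.biUnion (to_countable _) fun i _ => hs i
  have hmem : ∀ n, ind P (hacc n) ∈ K := by
    intro n
    induction n with
    | zero =>
      rw [ind_congr (hacc 0) (hs 0) (EventuallyEq.of_eq (accumulate_zero_nat s))]
      exact h 0
    | succ n ih =>
      rw [ind_congr (hacc (n + 1)) ((hacc n).union (hs (n + 1)))
        (EventuallyEq.of_eq (accumulate_succ s n)), ind_union (hacc n) (hs (n + 1))]
      exact sup_mem_of_abs_mem habs ih (h _)
  have hlim := tendsto_ind_iUnion (P := P) hacc monotone_accumulate
  rw [ind_congr (MeasurableSet.iUnion hacc) (MeasurableSet.iUnion hs)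
    (EventuallyEq.of_eq iUnion_accumulate)] at hlim
  exact hK.mem_of_tendsto hlim (Eventually.of_forall hmem)

lemma continuous_abs_Lp : Continuous fun f : Lp ℝ 2 P => |f| :=
  (LipschitzWith.of_dist_le_mul (K := 1) fun f g => by
    rw [dist_eq_norm, dist_eq_norm, NNReal.coe_one, one_mul]
    exact norm_abs_sub_abs f g).continuous

/-- The sub-σ-field of the sets whose indicators belong to a closed sublattice of `L₂`. -/
def ofSublattice (K : Submodule ℝ (Lp ℝ 2 P)) (hK : IsClosed (K : Set (Lp ℝ 2 P)))
    (habs : ∀ f ∈ K, |f| ∈ K) (huniv : ind P MeasurableSet.univ ∈ K) : SubSigmaField P where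
  toMeasurableSpace :=
    { MeasurableSet' := fun s => ∃ hs : MeasurableSet s, ind P hs ∈ K
      measurableSet_empty := ⟨MeasurableSet.empty, by
        have : ind P (MeasurableSet.empty : MeasurableSet (∅ : Set Ω)) = 0 :=
          indicatorConstLp_empty
        exact this ▸ K.zero_mem⟩
      measurableSet_compl := fun s ⟨hs, h⟩ => ⟨hs.compl, by
        rw [ind_compl hs]
        exact K.sub_mem huniv h⟩
      measurableSet_iUnion := fun f hf => by
        choose hfm hfK using hf
        exact ⟨MeasurableSet.iUnion hfm, ind_iUnion_mem hK habs hfm hfK⟩ }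
  le := fun s hs => hs.1
  measurableSet_of_null := fun s hs h0 => ⟨hs, by
    have : ind P (MeasurableSet.empty : MeasurableSet (∅ : Set Ω)) = 0 := indicatorConstLp_empty
    rw [ind_congr hs MeasurableSet.empty (ae_eq_empty.2 h0), this]
    exact K.zero_mem⟩

/-- A closed sublattice of `L₂` containing the constants is `L₂(E)` for a sub-σ-field `E`. -/
theorem space_ofSublattice {K : Submodule ℝ (Lp ℝ 2 P)} (hK : IsClosed (K : Set (Lp ℝ 2 P)))
    (habs : ∀ f ∈ K, |f| ∈ K) (huniv : ind P MeasurableSet.univ ∈ K) :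
    (ofSublattice K hK habs huniv).space = K := by
  set E := ofSublattice K hK habs huniv
  refine le_antisymm ?_ fun f hf => ?_
  · exact lpMeas_le_of_generateFrom E.le
      (@MeasurableSpace.generateFrom_measurableSet Ω E.toMeasurableSpace).symm
      (@MeasurableSpace.isPiSystem_measurableSet Ω E.toMeasurableSpace) hK huniv
      fun s hs _ => Exists.elim hs fun _ h => h
  · have : Measurable[E.toMeasurableSpace] f :=
      measurable_of_Ioi fun a => ⟨_, ind_level_mem hK habs huniv hf a⟩
    exact this.stronglyMeasurable.aestronglyMeasurable

end

/-! ### Strong limits of conditional expectations -/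

variable [IsProbabilityMeasure P]

/-- The elements of `L₂` that are limits of their conditional expectations along a filter. -/
noncomputable def limitSpace (l : Filter (SubSigmaField P)) : Submodule ℝ (Lp ℝ 2 P) where
  carrier := {f | Tendsto (fun E : SubSigmaField P => E.proj f) l (𝓝 f)}
  zero_mem' := by
    simp only [mem_ofPred_eq, map_zero]
    exact tendsto_const_nhds
  add_mem' := fun {f g} hf hg => by
    simp only [mem_ofPred_eq, map_add] at hf hg ⊢
    exact hf.add hg
  smul_mem' := fun c f hf => by
    simp only [mem_ofPred_eq, map_smul] at hf ⊢
    exact hf.const_smul c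

lemma mem_limitSpace {l : Filter (SubSigmaField P)} {f : Lp ℝ 2 P} :
    f ∈ limitSpace l ↔ Tendsto (fun E : SubSigmaField P => E.proj f) l (𝓝 f) := Iff.rfl

lemma isClosed_limitSpace (l : Filter (SubSigmaField P)) :
    IsClosed (limitSpace l : Set (Lp ℝ 2 P)) :=
  isClosed_setOf_tendsto (Φ₀ := id) (fun E : SubSigmaField P => E.lipschitzWith_proj)
    LipschitzWith.id

/-- The projection of `f` is the best approximation, so it is at least as close to `f` as `u E` is.
-/
lemma mem_limitSpace_of_tendsto {l : Filter (SubSigmaField P)} {u : SubSigmaField P → Lp ℝ 2 P}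
    {f : Lp ℝ 2 P} (hu : ∀ E, u E ∈ E.space) (hf : Tendsto u l (𝓝 f)) : f ∈ limitSpace l := by
  rw [mem_limitSpace, tendsto_iff_norm_sub_tendsto_zero]
  refine squeeze_zero (fun _ => norm_nonneg _) (fun E => ?_)
    (tendsto_iff_norm_sub_tendsto_zero.1 hf)
  rw [norm_sub_rev, norm_sub_rev (u E)]
  exact E.defect_le f (hu E)

lemma exists_space_eq_limitSpace (l : Filter (SubSigmaField P)) :
    ∃ E : SubSigmaField P, E.space = limitSpace l := by
  refine ⟨_, space_ofSublattice (isClosed_limitSpace l) (fun f hf => ?_) ?_⟩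
  · exact mem_limitSpace_of_tendsto (u := fun E => |E.proj f|)
      (fun E => abs_mem_space (E.proj_mem f)) ((continuous_abs_Lp.tendsto f).comp hf)
  · exact mem_limitSpace_of_tendsto (u := fun _ => ind P MeasurableSet.univ)
      (fun E => E.ind_univ_mem_space) tendsto_const_nhds

/-- The limit space is a closed sublattice with constants, hence of the form `L₂(E)`. It contains `Q
f`, and `f - Q f` is orthogonal to each `k` in it, as the limit of the vanishing inner products of
`f - F.proj f` with `F.proj k`. -/
lemma exists_proj_eq_of_tendsto {l : Filter (SubSigmaField P)} [NeBot l]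
    {Q : Lp ℝ 2 P → Lp ℝ 2 P}
    (hQ : ∀ f, Tendsto (fun E : SubSigmaField P => E.proj f) l (𝓝 (Q f))) :
    ∃ E : SubSigmaField P, ∀ f, E.proj f = Q f := by
  obtain ⟨E, hE⟩ := exists_space_eq_limitSpace l
  refine ⟨E, fun f => Submodule.eq_starProjection_of_mem_of_inner_eq_zero ?_ fun k hk => ?_⟩
  · rw [hE]
    exact mem_limitSpace_of_tendsto (fun E => E.proj_mem f) (hQ f)
  · rw [hE] at hk
    refine tendsto_nhds_unique
      (((tendsto_const_nhds (x := f)).sub (hQ f)).inner (mem_limitSpace.1 hk)) ?_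
    refine tendsto_const_nhds.congr fun F => ?_
    exact (Submodule.starProjection_inner_eq_zero _ _ (F.proj_mem k)).symm

lemma isClosed_range_proj {d : ℕ → Lp ℝ 2 P} (hd : DenseRange d) :
    IsClosed (range fun (E : SubSigmaField P) n => E.proj (d n)) := by
  refine isClosed_of_closure_subset fun y hy => ?_
  set F := fun (E : SubSigmaField P) n => E.proj (d n)
  set l : Filter (SubSigmaField P) := comap F (𝓝 y)
  have : NeBot l := comap_neBot_iff.2 fun t ht => by
    obtain ⟨_, hz, E, rfl⟩ := mem_closure_iff_nhds.1 hy t ht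
    exact ⟨E, hz⟩
  have htend : ∀ n, Tendsto (fun E : SubSigmaField P => E.proj (d n)) l (𝓝 (y n)) :=
    tendsto_pi_nhds.1 (tendsto_comap (f := F))
  -- Convergence on the dense sequence extends to all of `L₂` by nonexpansiveness and completeness.
  have hex : ∀ f, ∃ z, Tendsto (fun E : SubSigmaField P => E.proj f) l (𝓝 z) := fun f => by
    refine (isClosed_setOf_exists_tendsto (l := l) (Φ := fun (E : SubSigmaField P) => E.proj)
      fun E => E.lipschitzWith_proj).closure_subset_iff.2 ?_ (hd f)
    rintro _ ⟨n, rfl⟩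
    exact ⟨y n, htend n⟩
  choose Q hQ using hex
  obtain ⟨E, hE⟩ := exists_proj_eq_of_tendsto hQ
  exact ⟨E, funext fun n => (hE (d n)).trans (tendsto_nhds_unique (hQ (d n)) (htend n))⟩

lemma isClosedEmbedding_proj {d : ℕ → Lp ℝ 2 P} (hd : DenseRange d) :
    IsClosedEmbedding fun (E : SubSigmaField P) n => E.proj (d n) := by
  refine ⟨⟨isInducing_proj hd, fun E F h => space_injective ?_⟩, isClosed_range_proj hd⟩
  have h1 : (E.proj : Lp ℝ 2 P → Lp ℝ 2 P) = F.proj :=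
    hd.equalizer E.proj.continuous F.proj.continuous (funext fun n => congrFun h n)
  ext f
  rw [← proj_eq_self, ← proj_eq_self, h1]

instance [StandardBorelSpace Ω] : PolishSpace (Lp ℝ 2 P) := by
  have : Fact ((2 : ℝ≥0∞) ≠ ∞) := ⟨by simp⟩
  infer_instance

instance [StandardBorelSpace Ω] : PolishSpace (SubSigmaField P) :=
  (isClosedEmbedding_proj (TopologicalSpace.denseRange_denseSeq (Lp ℝ 2 P))).polishSpace

/-! ### Completion and the trivial sub-σ-field -/

/-- The sub-σ-field generated by a σ-field and the null sets. -/
def completion (P : Measure Ω) (_hm : m ≤ mΩ) : SubSigmaField P where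
  toMeasurableSpace := eventuallyMeasurableSpace m (ae P) ⊓ mΩ
  le := inf_le_right
  measurableSet_of_null _ hs h0 := MeasurableSpace.measurableSet_inf.2
    ⟨⟨∅, @MeasurableSet.empty Ω m, ae_eq_empty.2 h0⟩, hs⟩

lemma measurableSet_completion (hm : m ≤ mΩ) {s : Set Ω} :
    MeasurableSet[(completion P hm).toMeasurableSpace] s ↔
      (∃ t, MeasurableSet[m] t ∧ s =ᵐ[P] t) ∧ MeasurableSet s :=
  MeasurableSpace.measurableSet_inf

lemma le_completion (hm : m ≤ mΩ) :
    m ≤ (completion P hm).toMeasurableSpace := fun s hs =>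
  (measurableSet_completion hm).2 ⟨⟨s, hs, EventuallyEq.rfl⟩, hm s hs⟩

lemma completion_mono (hm : m ≤ mΩ) (hm' : m' ≤ mΩ) (h : m ≤ m') :
    (completion P hm).toMeasurableSpace ≤ (completion P hm').toMeasurableSpace := fun s hs => by
  obtain ⟨⟨t, ht, hst⟩, hs'⟩ := (measurableSet_completion hm).1 hs
  exact (measurableSet_completion hm').2 ⟨⟨t, h t ht, hst⟩, hs'⟩

/-- A set of the completion has the same class in `L₂` as some set of `m`, so adjoining null sets
does not enlarge the space. -/
lemma space_completion (hm : m ≤ mΩ) :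
    (completion P hm).space = lpMeas ℝ ℝ m 2 P := by
  refine le_antisymm ?_ fun f hf => AEStronglyMeasurable.mono (le_completion hm) hf
  have hcl : IsClosed (lpMeas ℝ ℝ m 2 P : Set (Lp ℝ 2 P)) := isClosed_aestronglyMeasurable hm
  have hmem : ∀ {s : Set Ω} (hs : MeasurableSet[m] s), ind P (hm s hs) ∈ lpMeas ℝ ℝ m 2 P :=
    fun hs => mem_lpMeas_indicatorConstLp hm hs _
  refine lpMeas_le_of_generateFrom (completion P hm).le
    (@MeasurableSpace.generateFrom_measurableSet Ω (completion P hm).toMeasurableSpace).symm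
    (@MeasurableSpace.isPiSystem_measurableSet Ω (completion P hm).toMeasurableSpace) hcl
    (hmem (@MeasurableSet.univ Ω m)) fun s hs hs' => ?_
  obtain ⟨⟨t, ht, hst⟩, -⟩ := (measurableSet_completion hm).1 hs
  rw [ind_congr hs' (hm t ht) hst]
  exact hmem ht

/-- Triviality becomes an inclusion in a fixed field, hence a closed condition. -/
lemma isTrivial_iff {E : SubSigmaField P} :
    E.IsTrivial ↔ E.toMeasurableSpace ≤
      (completion P (bot_le : (⊥ : MeasurableSpace Ω) ≤ mΩ)).toMeasurableSpace := by
  constructor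
  · intro h s hs
    refine (measurableSet_completion _).2 ⟨?_, E.le s hs⟩
    rcases h s hs with h | h
    · exact ⟨∅, @MeasurableSet.empty Ω ⊥, ae_eq_empty.2 h⟩
    · refine ⟨univ, @MeasurableSet.univ Ω ⊥, ?_⟩
      rw [ae_eq_univ, prob_compl_eq_zero_iff (E.le s hs), h]
  · intro h s hs
    obtain ⟨⟨t, ht, hst⟩, -⟩ := (measurableSet_completion _).1 (h s hs)
    rcases MeasurableSpace.measurableSet_bot_iff.1 ht with rfl | rfl
    · exact Or.inl (by rw [measure_congr hst, measure_empty])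
    · exact Or.inr (by rw [measure_congr hst, measure_univ])

end SubSigmaField

/-! ### Conditionally nonatomic sub-σ-fields form a `Gδ` set -/

/-- The diagonal map embeds the intersection into the product of the Polish spaces `U n`, onto the
closed set where all coordinates agree. -/
lemma polishSpace_iInter_isOpen {X : Type*} [TopologicalSpace X] [PolishSpace X] {U : ℕ → Set X}
    (hU : ∀ n, IsOpen (U n)) {p : X → Prop} (hp : ∀ x, p x ↔ ∀ n, x ∈ U n) :
    PolishSpace {x // p x} := by
  have : ∀ n, PolishSpace (U n) := fun n => (hU n).polishSpace
  set F : {x // p x} → ∀ n, U n := fun x n => ⟨x.1, (hp x.1).1 x.2 n⟩ with hF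
  have hFc : Continuous F :=
    continuous_pi fun n => continuous_subtype_val.subtype_mk _
  have hemb : IsEmbedding F := by
    refine IsEmbedding.of_comp hFc (g := fun y => (y 0 : X)) ?_ ?_
    · exact continuous_subtype_val.comp (continuous_apply 0)
    · exact IsEmbedding.subtypeVal
  refine IsClosedEmbedding.polishSpace (f := F) ⟨hemb, ?_⟩
  have : range F = ⋂ n, {y | (y n : X) = y 0} := by
    ext y
    simp only [mem_range, mem_iInter, mem_ofPred_eq]
    constructor
    · rintro ⟨x, rfl⟩ n
      rfl
    · intro h
      refine ⟨⟨y 0, (hp _).2 fun n => by rw [← h n]; exact (y n).2⟩, ?_⟩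
      funext n
      exact Subtype.ext (h n).symm
  rw [this]
  exact isClosed_iInter fun n => isClosed_eq
    (continuous_subtype_val.comp (continuous_apply n))
    (continuous_subtype_val.comp (continuous_apply 0))

section Cells

variable {Ω : Type*} [mΩ : MeasurableSpace Ω] [StandardBorelSpace Ω]

/-- The index of the interval of length `1 / n` containing the coordinate. -/
noncomputable def label (n : ℕ) (ω : Ω) : ℕ := ⌊n * coord Ω ω⌋₊

lemma measurable_label (n : ℕ) : Measurable (label n : Ω → ℕ) :=
  Nat.measurable_floor.comp ((measurable_coord Ω).const_mul _)

/-- The bound `n + 1` rather than `n` includes `n = 0`, where the only label is 0. -/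
lemma label_lt (n : ℕ) (ω : Ω) : label n ω < n + 1 := by
  rw [label, Nat.floor_lt (mul_nonneg (Nat.cast_nonneg _) (coord_pos ω).le)]
  have := mul_le_mul_of_nonneg_left (coord_lt_one ω).le (Nat.cast_nonneg (α := ℝ) n)
  push_cast
  linarith

lemma abs_coord_sub_lt {n : ℕ} {ω ω' : Ω} (h : label n ω = label n ω') :
    n * |coord Ω ω - coord Ω ω'| < 1 := by
  have h1 := Nat.floor_le (mul_nonneg (Nat.cast_nonneg (α := ℝ) n) (coord_pos ω).le)
  have h2 := Nat.lt_floor_add_one (n * coord Ω ω)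
  have h3 := Nat.floor_le (mul_nonneg (Nat.cast_nonneg (α := ℝ) n) (coord_pos ω').le)
  have h4 := Nat.lt_floor_add_one (n * coord Ω ω')
  unfold label at h
  rw [h] at h1 h2
  rw [← abs_of_nonneg (Nat.cast_nonneg (α := ℝ) n), ← abs_mul, abs_lt]
  constructor <;> linarith

/-- Two points of one cell have coordinates closer than `1 / n`, so the cell around `x` eventually
leaves out any given `y ≠ x`. -/
lemma tendsto_measureReal_fibre_label (ν : Measure Ω) [IsProbabilityMeasure ν] (x : Ω) :
    Tendsto (fun n => ν.real (label n ⁻¹' {label n x})) atTop (𝓝 (ν.real {x})) := by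
  refine (ENNReal.tendsto_toReal (measure_ne_top ν _)).comp ?_
  refine tendsto_measure_of_tendsto_indicator_of_isFiniteMeasure atTop ν
    (fun n => measurable_label n (measurableSet_singleton _)) ?_
  intro y
  by_cases hy : y = x
  · exact Eventually.of_forall fun n => by simp [hy]
  · have hne : 0 < |coord Ω y - coord Ω x| :=
      abs_pos.2 (sub_ne_zero.2 fun h => hy (coord_injective h))
    obtain ⟨N, hN⟩ := exists_nat_gt (1 / |coord Ω y - coord Ω x|)
    filter_upwards [eventually_ge_atTop N] with n hn
    simp only [mem_singleton_iff, hy, iff_false]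
    intro h
    have h1 := abs_coord_sub_lt (show label n y = label n x from h)
    rw [div_lt_iff₀ hne] at hN
    have h2 : (N : ℝ) ≤ n := by exact_mod_cast hn
    have := mul_le_mul_of_nonneg_right h2 hne.le
    linarith

/-- The sum of the squares of the probabilities of the first `N` fibres of a labelling. -/
noncomputable def sumSq (φ : Ω → ℕ) (N : ℕ) (ν : Measure Ω) : ℝ :=
  ∑ j ∈ Finset.range N, ν.real (φ ⁻¹' {j}) ^ 2

/-- The sum of the squares of the probabilities of the atoms. -/
noncomputable def sumSqAtoms (ν : Measure Ω) : ℝ := ∫ x, ν.real {x} ∂ν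

variable {φ : Ω → ℕ} {N : ℕ}

/-- The sum is the mean mass of the cell of a random point. In this form it dominates `sumSqAtoms`,
the mean mass of the point itself, and converges to it as the cells shrink. -/
lemma sumSq_eq_integral (hφ : Measurable φ) (hN : ∀ x, φ x < N) (ν : Measure Ω)
    [IsProbabilityMeasure ν] :
    sumSq φ N ν = ∫ x, ν.real (φ ⁻¹' {φ x}) ∂ν := by
  have hm : ∀ j, MeasurableSet (φ ⁻¹' {j}) := fun j => hφ (measurableSet_singleton j)
  have h : ∀ x, ν.real (φ ⁻¹' {φ x}) =
      ∑ j ∈ Finset.range N, (φ ⁻¹' {j}).indicator (fun _ => ν.real (φ ⁻¹' {j})) x := by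
    intro x
    rw [Finset.sum_eq_single (φ x)]
    · rw [indicator_of_mem (show x ∈ φ ⁻¹' {φ x} from rfl)]
    · intro j _ hj
      exact indicator_of_notMem (s := φ ⁻¹' {j})
        (fun h => hj (show φ x = j from h).symm) _
    · intro h
      exact absurd (Finset.mem_range.2 (hN x)) h
  simp_rw [h]
  rw [integral_finsetSum _ fun j _ => (integrable_const _).indicator (hm j)]
  refine Finset.sum_congr rfl fun j _ => ?_
  rw [integral_indicator_const _ (hm j), smul_eq_mul, sq]

lemma measurable_measureReal_fibre (hφ : Measurable φ) (ν : Measure Ω) :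
    Measurable fun x : Ω => ν.real (φ ⁻¹' {φ x}) :=
  (measurable_from_top (f := fun j => ν.real (φ ⁻¹' {j}))).comp hφ

lemma measurable_measureReal_singleton (ν : Measure Ω) [IsProbabilityMeasure ν] :
    Measurable fun x => ν.real {x} :=
  measurable_of_tendsto_metrizable (fun n => measurable_measureReal_fibre (measurable_label n) ν)
    (tendsto_pi_nhds.2 fun x => tendsto_measureReal_fibre_label ν x)

lemma integrable_of_mem_Icc {f : Ω → ℝ} {ν : Measure Ω} [IsProbabilityMeasure ν]
    (hf : AEStronglyMeasurable f ν) (h : ∀ x, f x ∈ Icc (0 : ℝ) 1) : Integrable f ν :=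
  Integrable.of_bound hf 1 (Eventually.of_forall fun x => by
    rw [Real.norm_eq_abs, abs_of_nonneg (h x).1]
    exact (h x).2)

lemma sumSqAtoms_le (hφ : Measurable φ) (hN : ∀ x, φ x < N) (ν : Measure Ω)
    [IsProbabilityMeasure ν] : sumSqAtoms ν ≤ sumSq φ N ν := by
  rw [sumSq_eq_integral hφ hN]
  refine integral_mono
    (integrable_of_mem_Icc (measurable_measureReal_singleton ν).aestronglyMeasurable
      fun x => ⟨measureReal_nonneg, measureReal_le_one⟩)
    (integrable_of_mem_Icc (measurable_measureReal_fibre hφ ν).aestronglyMeasurable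
      fun x => ⟨measureReal_nonneg, measureReal_le_one⟩) fun x => ?_
  exact measureReal_mono (singleton_subset_iff.2 (show φ x = φ x from rfl))

lemma tendsto_sumSq (ν : Measure Ω) [IsProbabilityMeasure ν] :
    Tendsto (fun n => sumSq (label n) (n + 1) ν) atTop (𝓝 (sumSqAtoms ν)) := by
  simp_rw [fun n => sumSq_eq_integral (measurable_label n) (label_lt n) ν]
  refine tendsto_integral_of_dominated_convergence (fun _ => 1)
    (fun n => (measurable_measureReal_fibre (measurable_label n) ν).aestronglyMeasurable)
    (integrable_const 1)
    (fun n => Eventually.of_forall fun x => ?_)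
    (Eventually.of_forall fun x => tendsto_measureReal_fibre_label ν x)
  rw [Real.norm_eq_abs, abs_of_nonneg measureReal_nonneg]
  exact measureReal_le_one

lemma sumSq_mem_Icc (hφ : Measurable φ) (hN : ∀ x, φ x < N) (ν : Measure Ω)
    [IsProbabilityMeasure ν] : sumSq φ N ν ∈ Icc (0 : ℝ) 1 := by
  refine ⟨Finset.sum_nonneg fun j _ => sq_nonneg _, ?_⟩
  rw [sumSq_eq_integral hφ hN]
  refine (integral_mono (integrable_of_mem_Icc
    (measurable_measureReal_fibre hφ ν).aestronglyMeasurable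
    fun x => ⟨measureReal_nonneg, measureReal_le_one⟩) (integrable_const (1 : ℝ))
    fun x => measureReal_le_one).trans ?_
  simp

lemma sumSqAtoms_nonneg (ν : Measure Ω) : 0 ≤ sumSqAtoms ν :=
  integral_nonneg fun _ => measureReal_nonneg

lemma sumSqAtoms_eq_zero {ν : Measure Ω} [IsProbabilityMeasure ν] :
    sumSqAtoms ν = 0 ↔ NullSingletonClass ν := by
  have hint := integrable_of_mem_Icc (ν := ν)
    (measurable_measureReal_singleton ν).aestronglyMeasurable
    fun x => ⟨measureReal_nonneg, measureReal_le_one⟩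
  rw [sumSqAtoms, integral_eq_zero_iff_of_nonneg (fun _ => measureReal_nonneg) hint]
  constructor
  · refine fun h => ⟨fun x => ?_⟩
    by_contra hx
    have hx' : x ∉ {y | ¬ ν.real {y} = 0} := fun hmem => hx
      (measure_mono_null (singleton_subset_iff.2 hmem) h)
    exact hx ((measureReal_eq_zero_iff).1 (not_not.1 hx'))
  · intro h
    exact Eventually.of_forall fun x => by simp [Measure.real]

end Cells

/-! ### Conditional nonatomicity through squared conditional probabilities -/

namespace SubSigmaField

variable {Ω : Type*} [mΩ : MeasurableSpace Ω] [StandardBorelSpace Ω] {P : Measure Ω}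
  [IsProbabilityMeasure P]

/-- This ties the conditional measures, which do not depend continuously on `E`, to a quantity that
does. -/
lemma norm_proj_ind_sq (E : SubSigmaField P) {s : Set Ω} (hs : MeasurableSet s) :
    ‖E.proj (ind P hs)‖ ^ 2 =
      ∫ ω, (condExpKernel P E.toMeasurableSpace ω).real s ^ 2 ∂P := by
  have h1 : (E.proj (ind P hs) : Ω → ℝ) =ᵐ[P] P⟦s | E.toMeasurableSpace⟧ :=
    (memLp_indicator_const 2 hs (1 : ℝ) (Or.inr (measure_ne_top P s))).condExpL2_ae_eq_condExp
      E.le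
  rw [← real_inner_self_eq_norm_sq, L2.inner_def]
  refine integral_congr_ae ?_
  filter_upwards [h1, condExpKernel_ae_eq_condExp E.le (μ := P) hs] with ω h2 h3
  rw [h2, h3]
  simp [sq]

lemma measurable_condExpKernel_real (E : SubSigmaField P) {s : Set Ω} (hs : MeasurableSet s) :
    Measurable fun ω => (condExpKernel P E.toMeasurableSpace ω).real s :=
  ((measurable_condExpKernel hs).mono E.le le_rfl).ennreal_toReal

variable {φ : Ω → ℕ} {N : ℕ}

/-- The mean of the sum of the squares of the conditional probabilities of the first `N` fibres of
a labelling. -/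
noncomputable def meanSumSq (hφ : Measurable φ) (N : ℕ) (E : SubSigmaField P) : ℝ :=
  ∑ j ∈ Finset.range N, ‖E.proj (ind P (hφ (measurableSet_singleton j)))‖ ^ 2

lemma continuous_meanSumSq (hφ : Measurable φ) :
    Continuous (meanSumSq hφ N : SubSigmaField P → ℝ) :=
  continuous_finsetSum _ fun _ _ => (continuous_proj _).norm.pow 2

lemma measurable_sumSq (hφ : Measurable φ) (E : SubSigmaField P) :
    Measurable fun ω => sumSq φ N (condExpKernel P E.toMeasurableSpace ω) :=
  Finset.measurable_fun_sum _ fun _ _ =>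
    (E.measurable_condExpKernel_real (hφ (measurableSet_singleton _))).pow_const 2

lemma meanSumSq_eq_integral (hφ : Measurable φ) (E : SubSigmaField P) :
    meanSumSq hφ N E = ∫ ω, sumSq φ N (condExpKernel P E.toMeasurableSpace ω) ∂P := by
  unfold sumSq
  rw [integral_finsetSum]
  · exact Finset.sum_congr rfl fun j _ => E.norm_proj_ind_sq _
  · intro j _
    refine integrable_of_mem_Icc ((E.measurable_condExpKernel_real
      (hφ (measurableSet_singleton j))).pow_const 2).aestronglyMeasurable
      fun x => ⟨sq_nonneg _, pow_le_one₀ measureReal_nonneg measureReal_le_one⟩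

lemma measurable_sumSqAtoms (E : SubSigmaField P) :
    Measurable fun ω => sumSqAtoms (condExpKernel P E.toMeasurableSpace ω) :=
  measurable_of_tendsto_metrizable (fun n => measurable_sumSq (measurable_label n) E)
    (tendsto_pi_nhds.2 fun ω => tendsto_sumSq (condExpKernel P E.toMeasurableSpace ω))

lemma integrable_sumSq (hφ : Measurable φ) (hN : ∀ x, φ x < N) (E : SubSigmaField P) :
    Integrable (fun ω => sumSq φ N (condExpKernel P E.toMeasurableSpace ω)) P :=
  integrable_of_mem_Icc (measurable_sumSq hφ E).aestronglyMeasurable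
    fun _ => sumSq_mem_Icc hφ hN _

lemma integrable_sumSqAtoms (E : SubSigmaField P) :
    Integrable (fun ω => sumSqAtoms (condExpKernel P E.toMeasurableSpace ω)) P :=
  integrable_of_mem_Icc (measurable_sumSqAtoms E).aestronglyMeasurable
    -- The partition `label 0` into a single cell provides the bound 1.
    fun _ => ⟨sumSqAtoms_nonneg _, (sumSqAtoms_le (measurable_label 0) (label_lt 0) _).trans
      (sumSq_mem_Icc (measurable_label 0) (label_lt 0) _).2⟩

lemma isCondNonatomic_iff_integral {E : SubSigmaField P} : E.IsCondNonatomic ↔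
    ∫ ω, sumSqAtoms (condExpKernel P E.toMeasurableSpace ω) ∂P = 0 := by
  rw [integral_eq_zero_iff_of_nonneg (fun _ => sumSqAtoms_nonneg _) (integrable_sumSqAtoms E)]
  refine eventually_congr (Eventually.of_forall fun ω => ?_)
  exact sumSqAtoms_eq_zero.symm

/-- A sub-σ-field is conditionally nonatomic if some finite partitions have small mean sums of
squared conditional probabilities. -/
theorem isCondNonatomic_of_forall_exists {E : SubSigmaField P}
    (h : ∀ k : ℕ, ∃ (φ : Ω → ℕ) (hφ : Measurable φ) (N : ℕ), (∀ x, φ x < N) ∧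
      meanSumSq hφ N E < 1 / ((k : ℝ) + 1)) : E.IsCondNonatomic := by
  refine isCondNonatomic_iff_integral.2
    (le_antisymm ?_ (integral_nonneg fun _ => sumSqAtoms_nonneg _))
  refine ge_of_tendsto' (tendsto_one_div_add_atTop_nhds_zero_nat (𝕜 := ℝ)) fun k => ?_
  obtain ⟨φ, hφ, N, hN, hlt⟩ := h k
  rw [meanSumSq_eq_integral] at hlt
  exact (integral_mono (integrable_sumSqAtoms E) (integrable_sumSq hφ hN E)
    fun ω => sumSqAtoms_le hφ hN _).trans hlt.le

/-- A sub-σ-field is conditionally nonatomic iff fine partitions have small mean sums of squared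
conditional probabilities. -/
theorem isCondNonatomic_iff {E : SubSigmaField P} :
    E.IsCondNonatomic ↔
      ∀ k : ℕ, ∃ n, meanSumSq (measurable_label n) (n + 1) E < 1 / ((k : ℝ) + 1) := by
  constructor
  · intro h k
    -- Dominated convergence over `ω`, applied to the conditional measures; the limit vanishes
    -- exactly when almost all of them are nonatomic.
    have hlim : Tendsto (fun n => meanSumSq (measurable_label n) (n + 1) E) atTop
        (𝓝 (∫ ω, sumSqAtoms (condExpKernel P E.toMeasurableSpace ω) ∂P)) := by
      simp_rw [fun n => meanSumSq_eq_integral (N := n + 1) (measurable_label n) E]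
      refine tendsto_integral_of_dominated_convergence (fun _ => 1)
        (fun n => (measurable_sumSq (measurable_label n) E).aestronglyMeasurable)
        (integrable_const 1) (fun n => Eventually.of_forall fun ω => ?_)
        (Eventually.of_forall fun ω => tendsto_sumSq _)
      have hmem := sumSq_mem_Icc (measurable_label n) (label_lt n)
        (condExpKernel P E.toMeasurableSpace ω)
      rw [Real.norm_eq_abs, abs_of_nonneg hmem.1]
      exact hmem.2
    rw [isCondNonatomic_iff_integral.1 h] at hlim
    exact (hlim.eventually_lt_const Nat.one_div_pos_of_nat).exists
  · exact fun h => isCondNonatomic_of_forall_exists fun k =>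
      (h k).imp' label fun n hn => ⟨measurable_label n, n + 1, label_lt n, hn⟩

end SubSigmaField

/-! ### The Polish space of filtrations -/

section FiltrationPolish

variable {Ω : Type*} [mΩ : MeasurableSpace Ω] [StandardBorelSpace Ω] {P : Measure Ω}
  [IsProbabilityMeasure P]

/-- For each `k`, having some fine partition with mean sum of squares below `1 / (k + 1)` is an open
condition, because each such sum is continuous in the field. -/
instance : PolishSpace (CondNonatomicField P) :=
  polishSpace_iInter_isOpen
    (U := fun k => ⋃ n, {E : SubSigmaField P |
      SubSigmaField.meanSumSq (measurable_label n) (n + 1) E < 1 / ((k : ℝ) + 1)})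
    (fun _ => isOpen_iUnion fun n =>
      isOpen_lt (SubSigmaField.continuous_meanSumSq (measurable_label n)) continuous_const)
    fun E => by simpa using SubSigmaField.isCondNonatomic_iff

lemma polishSpace_continuousMap {T Y : Type*} [TopologicalSpace T] [CompactSpace T]
    [T2Space T] [SecondCountableTopology T] [TopologicalSpace Y] [PolishSpace Y] :
    PolishSpace C(T, Y) := by
  let := TopologicalSpace.upgradeIsCompletelyMetrizable Y
  infer_instance

lemma isClosed_setOf_isFiltration (T : Set ℝ≥0∞) :
    IsClosed {x : C(T, CondNonatomicField P) | IsFiltration x} := by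
  have hev : ∀ (t : T) (f : Lp ℝ 2 P),
      Continuous fun x : C(T, CondNonatomicField P) => (x t).1.defect f := fun t f =>
    (SubSigmaField.continuous_defect f).comp
      (continuous_subtype_val.comp (continuous_eval_const t))
  have hle : ∀ s t : T, IsClosed {x : C(T, CondNonatomicField P) |
      (x s).1.toMeasurableSpace ≤ (x t).1.toMeasurableSpace} := fun s t => by
    simp_rw [SubSigmaField.le_iff_defect_le, ofPred_forall]
    exact isClosed_iInter fun f => isClosed_le (hev t f) (hev s f)
  have htriv : ∀ t : T, IsClosed {x : C(T, CondNonatomicField P) | (x t).1.IsTrivial} :=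
    fun t => by
    simp_rw [SubSigmaField.isTrivial_iff, SubSigmaField.le_iff_defect_le, ofPred_forall]
    exact isClosed_iInter fun f => isClosed_le continuous_const (hev t f)
  have heq : {x : C(T, CondNonatomicField P) | IsFiltration x} =
      (⋂ (s : T) (t : T) (_ : s ≤ t), {x : C(T, CondNonatomicField P) |
        (x s).1.toMeasurableSpace ≤ (x t).1.toMeasurableSpace}) ∩
      ⋂ (t : T) (_ : ∀ s : T, t ≤ s), {x : C(T, CondNonatomicField P) | (x t).1.IsTrivial} := by
    ext x
    simp only [mem_ofPred_eq, mem_inter_iff, mem_iInter]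
    exact ⟨fun h => ⟨h.mono, h.trivial_of_least⟩, fun h => ⟨h.1, h.2⟩⟩
  rw [heq]
  exact (isClosed_iInter fun s => isClosed_iInter fun t => isClosed_iInter fun _ => hle s t).inter
    (isClosed_iInter fun t => isClosed_iInter fun _ => htriv t)

lemma polishSpace_filtrationSpace {T : Set ℝ≥0∞} (hT : IsCompact T) :
    PolishSpace (FiltrationSpace P T) := by
  have : CompactSpace T := isCompact_iff_compactSpace.1 hT
  have : PolishSpace C(T, CondNonatomicField P) := polishSpace_continuousMap
  exact (isClosed_setOf_isFiltration T).polishSpace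

end FiltrationPolish

/-! ### Composition operators on `L₂` -/

section Koopman

variable {Ω : Type*} [mΩ : MeasurableSpace Ω] {P : Measure Ω} [IsProbabilityMeasure P]

/-- The isometry `f ↦ f ∘ T` of `L₂`. -/
noncomputable abbrev koop {T : Ω → Ω} (hT : MeasurePreserving T P P) :
    Lp ℝ 2 P →ₗᵢ[ℝ] Lp ℝ 2 P := Lp.compMeasurePreservingₗᵢ ℝ T hT

lemma coeFn_koop {T : Ω → Ω} (hT : MeasurePreserving T P P) (f : Lp ℝ 2 P) :
    koop hT f =ᵐ[P] f ∘ T := Lp.coeFn_compMeasurePreserving f hT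

lemma koop_ind {T : Ω → Ω} (hT : MeasurePreserving T P P) {s : Set Ω} (hs : MeasurableSet s) :
    koop hT (ind P hs) = ind P (hT.measurable hs) := rfl

lemma koop_sup {T : Ω → Ω} (hT : MeasurePreserving T P P) (f g : Lp ℝ 2 P) :
    koop hT (f ⊔ g) = koop hT f ⊔ koop hT g := by
  ext1
  filter_upwards [coeFn_koop hT (f ⊔ g), coeFn_koop hT f, coeFn_koop hT g,
    Lp.coeFn_sup (koop hT f) (koop hT g),
    hT.quasiMeasurePreserving.ae (Lp.coeFn_sup f g)] with x h1 h2 h3 h4 h5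
  rw [h1, h4, Pi.sup_apply, h2, h3, Function.comp_apply, h5]
  rfl

lemma koop_abs {T : Ω → Ω} (hT : MeasurePreserving T P P) (f : Lp ℝ 2 P) :
    koop hT |f| = |koop hT f| := by
  rw [abs, abs, koop_sup, map_neg]

lemma koop_inf {T : Ω → Ω} (hT : MeasurePreserving T P P) (f g : Lp ℝ 2 P) :
    koop hT (f ⊓ g) = koop hT f ⊓ koop hT g := by
  have h : ∀ a b : Lp ℝ 2 P, a ⊓ b = a + b - a ⊔ b := fun a b => by
    rw [eq_sub_iff_add_eq]; exact inf_add_sup a b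
  rw [h, h, map_sub, map_add, koop_sup]

lemma koop_congr {S T : Ω → Ω} (hS : MeasurePreserving S P P) (hT : MeasurePreserving T P P)
    (h : S =ᵐ[P] T) : koop hS = koop hT := by
  ext1 f
  ext1
  filter_upwards [coeFn_koop hS f, coeFn_koop hT f, h] with x h1 h2 h3
  rw [h1, h2, Function.comp_apply, Function.comp_apply, h3]

lemma koop_comp {S T : Ω → Ω} (hS : MeasurePreserving S P P) (hT : MeasurePreserving T P P)
    (f : Lp ℝ 2 P) : koop (hS.comp hT) f = koop hT (koop hS f) :=
  Lp.compMeasurePreserving_comp_apply f hS hT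

lemma koop_levelApprox {T : Ω → Ω} (hT : MeasurePreserving T P P) (f : Lp ℝ 2 P) (a : ℝ) (n : ℕ) :
    koop hT (levelApprox f a n) = levelApprox (koop hT f) a n := by
  rw [levelApprox, koop_inf, map_smul, koop_sup, map_sub, map_smul, map_zero]
  rfl

lemma continuous_levelApprox (a : ℝ) (n : ℕ) :
    Continuous fun f : Lp ℝ 2 P => levelApprox f a n := by
  have h1 : Continuous fun f : Lp ℝ 2 P => f - a • ind P MeasurableSet.univ :=
    continuous_id.sub continuous_const
  have h2 : Continuous fun f : Lp ℝ 2 P => (f - a • ind P MeasurableSet.univ) ⊔ 0 :=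
    h1.sup continuous_const
  exact (h2.const_smul (n : ℝ)).inf continuous_const

lemma dist_ind_sq {s t : Set Ω} (hs : MeasurableSet s) (ht : MeasurableSet t) :
    dist (ind P hs) (ind P ht) ^ 2 = P.real (s ∆ t) := by
  rw [ind, ind, dist_indicatorConstLp_eq_norm]
  exact norm_ind_sq (hs.symmDiff ht)

variable {ι : Type*}

/-- The elements of `L₂` on which composition operators converge. -/
noncomputable def koopLimitSpace (l : Filter ι) {T : ι → Ω → Ω}
    (hT : ∀ i, MeasurePreserving (T i) P P) {S : Ω → Ω} (hS : MeasurePreserving S P P) :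
    Submodule ℝ (Lp ℝ 2 P) where
  carrier := {f | Tendsto (fun i => koop (hT i) f) l (𝓝 (koop hS f))}
  zero_mem' := by
    simp only [mem_ofPred_eq, map_zero]
    exact tendsto_const_nhds
  add_mem' := fun {f g} hf hg => by
    simp only [mem_ofPred_eq, map_add] at hf hg ⊢
    exact hf.add hg
  smul_mem' := fun c f hf => by
    simp only [mem_ofPred_eq, map_smul] at hf ⊢
    exact hf.const_smul c

variable {l : Filter ι} {T : ι → Ω → Ω} {hT : ∀ i, MeasurePreserving (T i) P P} {S : Ω → Ω}
  {hS : MeasurePreserving S P P}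

lemma mem_koopLimitSpace {f : Lp ℝ 2 P} :
    f ∈ koopLimitSpace l hT hS ↔ Tendsto (fun i => koop (hT i) f) l (𝓝 (koop hS f)) := Iff.rfl

lemma isClosed_koopLimitSpace : IsClosed (koopLimitSpace l hT hS : Set (Lp ℝ 2 P)) :=
  isClosed_setOf_tendsto (fun i => (koop (hT i)).lipschitz) (koop hS).lipschitz

lemma abs_mem_koopLimitSpace (f : Lp ℝ 2 P) (hf : f ∈ koopLimitSpace l hT hS) :
    |f| ∈ koopLimitSpace l hT hS := by
  rw [mem_koopLimitSpace] at hf ⊢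
  simp_rw [koop_abs]
  exact (SubSigmaField.continuous_abs_Lp.tendsto _).comp hf

lemma ind_univ_mem_koopLimitSpace : ind P MeasurableSet.univ ∈ koopLimitSpace l hT hS := by
  rw [mem_koopLimitSpace]
  exact tendsto_const_nhds

lemma tendsto_koop_of_forall_ind
    (h : ∀ (s : Set Ω) (hs : MeasurableSet s),
      Tendsto (fun i => koop (hT i) (ind P hs)) l (𝓝 (koop hS (ind P hs)))) (f : Lp ℝ 2 P) :
    Tendsto (fun i => koop (hT i) f) l (𝓝 (koop hS f)) := by
  have := eq_top_of_generateFrom MeasurableSpace.generateFrom_measurableSet.symm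
    MeasurableSpace.isPiSystem_measurableSet (isClosed_koopLimitSpace (l := l) (hT := hT) (hS := hS))
    ind_univ_mem_koopLimitSpace fun s _ hs => h s hs
  rw [← mem_koopLimitSpace, this]
  trivial

variable [StandardBorelSpace Ω]

/-- The functions on which convergence holds form a closed sublattice with constants, and the
coordinate generates all of `L₂` as such a lattice. -/
lemma tendsto_koop_of_coordLp
    (h : Tendsto (fun i => koop (hT i) (coordLp P)) l (𝓝 (koop hS (coordLp P)))) (f : Lp ℝ 2 P) :
    Tendsto (fun i => koop (hT i) f) l (𝓝 (koop hS f)) := by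
  have := eq_top_of_coordLp_mem P (isClosed_koopLimitSpace (l := l) (hT := hT) (hS := hS))
    abs_mem_koopLimitSpace ind_univ_mem_koopLimitSpace h
  rw [← mem_koopLimitSpace, this]
  trivial

/-- The approximations of level sets are continuous lattice operations commuting with composition
operators, which are isometric. Hence their norms agree for `η` and `f`, and in the limit so do the
probabilities of the level sets. -/
lemma map_eq_of_tendsto_koop [NeBot l] {f η : Lp ℝ 2 P}
    (h : Tendsto (fun i => koop (hT i) f) l (𝓝 η)) : P.map η = P.map f := by
  have hnorm : ∀ a n, ‖levelApprox η a n‖ = ‖levelApprox f a n‖ := fun a n => by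
    refine tendsto_nhds_unique
      ((((continuous_levelApprox a n).tendsto η).comp h).norm) ?_
    refine tendsto_const_nhds.congr fun i => ?_
    rw [Function.comp_apply, ← koop_levelApprox, LinearIsometry.norm_map]
  have hreal : ∀ a, P.real {x | a < η x} = P.real {x | a < f x} := fun a => by
    rw [← norm_ind_sq (measurableSet_lt measurable_const (measurable_coeFn η)),
      ← norm_ind_sq (measurableSet_lt measurable_const (measurable_coeFn f))]
    congr 1
    refine tendsto_nhds_unique (tendsto_levelApprox η a).norm ?_
    simp_rw [hnorm]
    exact (tendsto_levelApprox f a).norm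
  have hm : ∀ g : Lp ℝ 2 P, IsProbabilityMeasure (P.map g) := fun g =>
    Measure.isProbabilityMeasure_map (measurable_coeFn g).aemeasurable
  refine Measure.ext_of_Iic _ _ fun a => ?_
  have hc : ∀ g : Lp ℝ 2 P, P.map g (Iic a) = 1 - P {x | a < g x} := fun g => by
    rw [Measure.map_apply (measurable_coeFn g) measurableSet_Iic,
      ← prob_compl_eq_one_sub (measurableSet_lt measurable_const (measurable_coeFn g))]
    congr 1
    ext x
    simp
  rw [hc, hc, (measureReal_eq_measureReal_iff).1 (hreal a)]

/-- A limit of the compositions of the coordinate with measure preserving maps is the composition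
of the coordinate with a measure preserving map. -/
lemma exists_koop_eq_of_tendsto [NeBot l] {η : Lp ℝ 2 P}
    (h : Tendsto (fun i => koop (hT i) (coordLp P)) l (𝓝 η)) :
    ∃ (S : Ω → Ω) (hS : MeasurePreserving S P P), koop hS (coordLp P) = η := by
  have hlaw : P.map η = P.map (coord Ω) :=
    (map_eq_of_tendsto_koop h).trans (Measure.map_congr (coeFn_coordLp P))
  have hne : Nonempty Ω := nonempty_of_isProbabilityMeasure P
  -- `r` is a measurable left inverse of the coordinate; since `η` has the law of the coordinate, it
  -- takes values in its range almost surely and `r ∘ η` is the required map.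
  obtain ⟨r, hr, hrc⟩ := (measurableEmbedding_coord Ω).exists_measurable_extend measurable_id
    fun _ => hne
  have hrange : ∀ᵐ ω ∂P, η ω ∈ range (coord Ω) := by
    have hm := (measurableEmbedding_coord Ω).measurableSet_range
    refine (ae_map_iff (measurable_coeFn η).aemeasurable hm).1 ?_
    rw [hlaw]
    exact (ae_map_iff (measurable_coord Ω).aemeasurable hm).2
      (Eventually.of_forall fun ω => mem_range_self ω)
  have hS : MeasurePreserving (r ∘ η) P P := by
    refine ⟨hr.comp (measurable_coeFn η), ?_⟩
    rw [← Measure.map_map hr (measurable_coeFn η), hlaw, Measure.map_map hr (measurable_coord Ω),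
      hrc, Measure.map_id]
  refine ⟨r ∘ η, hS, ?_⟩
  ext1
  filter_upwards [coeFn_koop hS (coordLp P), hS.quasiMeasurePreserving.ae (coeFn_coordLp P),
    hrange] with ω h1 h2 h3
  obtain ⟨ω', hω'⟩ := h3
  rw [h1, Function.comp_apply, h2, Function.comp_apply, ← hω']
  exact congrArg _ (congrFun hrc ω')

end Koopman

/-! ### The Polish group of automorphisms -/

section AutPolish

variable {Ω : Type*} [mΩ : MeasurableSpace Ω] {P : Measure Ω} [IsProbabilityMeasure P]

/-- The composition operator of an invertible measure preserving map. -/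
noncomputable abbrev koopPerm (e : mpPerm P) : Lp ℝ 2 P →ₗᵢ[ℝ] Lp ℝ 2 P := koop e.2.1

lemma koopPerm_koopPerm_inv (e : mpPerm P) (f : Lp ℝ 2 P) :
    koopPerm e (koopPerm e⁻¹ f) = f := by
  rw [← koop_comp]
  have : koop ((e⁻¹).2.1.comp e.2.1) = koop (MeasurePreserving.id P) :=
    koop_congr _ _ (Eventually.of_forall fun ω => (e : Equiv.Perm Ω).symm_apply_apply ω)
  rw [this]
  exact Lp.compMeasurePreserving_id_apply f

lemma imageSet_mul (g h : mpPerm P) (s : MeasuredSets P) :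
    imageSet P (g * h) s = imageSet P g (imageSet P h s) :=
  Subtype.ext (image_comp (g : Equiv.Perm Ω) (h : Equiv.Perm Ω) s.1)

lemma imageSet_one (s : MeasuredSets P) : imageSet P 1 s = s :=
  Subtype.ext (image_id s.1)

lemma dist_imageSet (g : mpPerm P) (s t : MeasuredSets P) :
    dist (imageSet P g s) (imageSet P g t) = dist s t := by
  rw [MeasuredSets.dist_def, MeasuredSets.dist_def]
  have h1 : ((imageSet P g s : Set Ω) ∆ (imageSet P g t : Set Ω)) =
      (g : Equiv.Perm Ω).symm ⁻¹' ((s : Set Ω) ∆ (t : Set Ω)) := by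
    change ((g : Equiv.Perm Ω) '' s.1) ∆ ((g : Equiv.Perm Ω) '' t.1) = _
    rw [Equiv.image_eq_preimage_symm, Equiv.image_eq_preimage_symm]
    rfl
  rw [h1]
  exact congrArg ENNReal.toReal
    (g.2.2.measure_preimage (s.2.symmDiff t.2).nullMeasurableSet)

lemma isInducing_imageSet : IsInducing fun (e : mpPerm P) (s : MeasuredSets P) => imageSet P e s :=
  ⟨rfl⟩

lemma tendsto_mpPerm_iff {ι : Type*} {l : Filter ι} {u : ι → mpPerm P} {g : mpPerm P} :
    Tendsto u l (𝓝 g) ↔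
      ∀ s : MeasuredSets P, Tendsto (fun i => dist (imageSet P (u i) s) (imageSet P g s)) l (𝓝 0) := by
  rw [isInducing_imageSet.tendsto_nhds_iff, tendsto_pi_nhds]
  exact forall_congr' fun s => tendsto_iff_dist_tendsto_zero

lemma tendsto_dist_imageSet (g : mpPerm P) (s : MeasuredSets P) :
    Tendsto (fun e => dist (imageSet P e s) (imageSet P g s)) (𝓝 g) (𝓝 0) :=
  tendsto_mpPerm_iff.1 tendsto_id s

/-- The group acts by isometries on measured sets, which gives joint continuity of the product and
lets an inverse be moved to the other side of a distance. -/
instance : IsTopologicalGroup (mpPerm P) where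
  continuous_mul := by
    rw [continuous_iff_continuousAt]
    rintro ⟨g, h⟩
    refine tendsto_mpPerm_iff.2 fun s => ?_
    have hlim : Tendsto (fun p : mpPerm P × mpPerm P =>
        dist (imageSet P p.2 s) (imageSet P h s) +
          dist (imageSet P p.1 (imageSet P h s)) (imageSet P g (imageSet P h s)))
        (𝓝 (g, h)) (𝓝 0) := by
      rw [nhds_prod_eq, ← add_zero (0 : ℝ)]
      exact ((tendsto_dist_imageSet h s).comp tendsto_snd).add
        ((tendsto_dist_imageSet g (imageSet P h s)).comp tendsto_fst)
    refine squeeze_zero (fun _ => dist_nonneg) (fun p => ?_) hlim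
    rw [imageSet_mul, imageSet_mul, ← dist_imageSet p.1 (imageSet P p.2 s)]
    exact dist_triangle _ _ _
  continuous_inv := by
    rw [continuous_iff_continuousAt]
    intro g
    refine tendsto_mpPerm_iff.2 fun s => ?_
    refine (tendsto_dist_imageSet g (imageSet P g⁻¹ s)).congr fun e => ?_
    have h : ∀ e : mpPerm P, imageSet P e (imageSet P e⁻¹ s) = s := fun e => by
      rw [← imageSet_mul, mul_inv_cancel, imageSet_one]
    rw [← dist_imageSet e (imageSet P e⁻¹ s), h, h, dist_comm]

lemma image_inv_eq_preimage (e : mpPerm P) (s : Set Ω) :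
    ((e⁻¹ : mpPerm P) : Equiv.Perm Ω) '' s = (e : Equiv.Perm Ω) ⁻¹' s :=
  Equiv.image_eq_preimage_symm _ _

lemma dist_imageSet_inv (e g : mpPerm P) (s : MeasuredSets P) :
    dist (imageSet P e⁻¹ s) (imageSet P g⁻¹ s) =
      dist (koopPerm e (ind P s.2)) (koopPerm g (ind P s.2)) ^ 2 := by
  rw [koop_ind, koop_ind, dist_ind_sq, MeasuredSets.dist_def]
  change P.real ((((e⁻¹ : mpPerm P) : Equiv.Perm Ω) '' s.1) ∆
    (((g⁻¹ : mpPerm P) : Equiv.Perm Ω) '' s.1)) = _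
  rw [image_inv_eq_preimage, image_inv_eq_preimage]

/-- Convergence in the group of measure preserving maps is strong convergence of composition
operators. -/
lemma tendsto_mpPerm_iff_koop {ι : Type*} {l : Filter ι} {u : ι → mpPerm P} {g : mpPerm P} :
    Tendsto u l (𝓝 g) ↔
      ∀ f, Tendsto (fun i => koopPerm (u i) f) l (𝓝 (koopPerm g f)) := by
  -- The topology is defined by images, while composition operators take preimages; passing to
  -- inverses reconciles the two.
  have hinv : Tendsto u l (𝓝 g) ↔ Tendsto (fun i => (u i)⁻¹) l (𝓝 g⁻¹) :=
    ⟨fun h => h.inv, fun h => by simpa using h.inv⟩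
  rw [hinv, tendsto_mpPerm_iff]
  simp_rw [dist_imageSet_inv]
  constructor
  · refine fun h => tendsto_koop_of_forall_ind fun s hs => tendsto_iff_dist_tendsto_zero.2 ?_
    have h1 := (h ⟨s, hs⟩).sqrt
    simpa [Real.sqrt_sq dist_nonneg] using h1
  · intro h s
    have := (tendsto_iff_dist_tendsto_zero.1 (h (ind P s.2))).pow 2
    simpa using this

lemma continuous_koopPerm (f : Lp ℝ 2 P) : Continuous fun e : mpPerm P => koopPerm e f :=
  continuous_iff_continuousAt.2 fun _ => tendsto_mpPerm_iff_koop.1 tendsto_id f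

/-! ### The closed embedding of the automorphism group into `L₂ × L₂` -/

variable [StandardBorelSpace Ω]

/-- The images of the coordinate under a measure preserving map and its inverse. -/
noncomputable def coordPair (e : mpPerm P) : Lp ℝ 2 P × Lp ℝ 2 P :=
  (koopPerm e (coordLp P), koopPerm e⁻¹ (coordLp P))

lemma continuous_coordPair : Continuous (coordPair : mpPerm P → _) :=
  (continuous_koopPerm _).prodMk ((continuous_koopPerm _).comp continuous_inv)

lemma isInducing_coordPair : IsInducing (coordPair : mpPerm P → _) := by
  rw [isInducing_iff_nhds]
  intro e
  refine le_antisymm (continuous_coordPair.tendsto e).le_comap ?_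
  rw [← tendsto_id', tendsto_mpPerm_iff_koop]
  refine fun f => tendsto_koop_of_coordLp ?_ f
  have h : Tendsto coordPair (comap coordPair (𝓝 (coordPair e))) (𝓝 (coordPair e)) :=
    tendsto_comap
  exact (continuous_fst.tendsto _).comp h

lemma mk_eq_mk_iff {e e' : mpPerm P} :
    (QuotientGroup.mk e : Aut P) = QuotientGroup.mk e' ↔
      (e : Equiv.Perm Ω) =ᵐ[P] (e' : Equiv.Perm Ω) := by
  rw [QuotientGroup.eq]
  change (∀ᵐ ω ∂P, (e : Equiv.Perm Ω).symm ((e' : Equiv.Perm Ω) ω) = ω) ↔ _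
  refine eventually_congr (Eventually.of_forall fun ω => ?_)
  rw [Equiv.symm_apply_eq, eq_comm]

lemma ae_eq_of_koop_coordLp_eq {S T : Ω → Ω} {hS : MeasurePreserving S P P}
    {hT : MeasurePreserving T P P} (h : koop hS (coordLp P) = koop hT (coordLp P)) :
    S =ᵐ[P] T := by
  have h' : koop hS (coordLp P) =ᵐ[P] koop hT (coordLp P) := by rw [h]
  filter_upwards [coeFn_koop hS (coordLp P), coeFn_koop hT (coordLp P), h',
    hS.quasiMeasurePreserving.ae (coeFn_coordLp P),
    hT.quasiMeasurePreserving.ae (coeFn_coordLp P)] with ω h1 h2 h3 h4 h5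
  rw [h1, h2, Function.comp_apply, Function.comp_apply, h4, h5] at h3
  exact coord_injective h3

lemma coordPair_eq_iff {e e' : mpPerm P} :
    coordPair e = coordPair e' ↔ (QuotientGroup.mk e : Aut P) = QuotientGroup.mk e' := by
  rw [mk_eq_mk_iff]
  constructor
  · exact fun h => ae_eq_of_koop_coordLp_eq (congrArg Prod.fst h)
  · intro h
    have h' : ((e⁻¹ : mpPerm P) : Equiv.Perm Ω) =ᵐ[P] ((e'⁻¹ : mpPerm P) : Equiv.Perm Ω) := by
      rw [← mk_eq_mk_iff] at h ⊢
      rw [QuotientGroup.mk_inv, QuotientGroup.mk_inv, h]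
    rw [coordPair, coordPair, koopPerm, koop_congr _ e'.2.1 h, koopPerm, koop_congr _ (e'⁻¹).2.1 h']

/-- The embedding of the automorphism group into `L₂ × L₂`. -/
noncomputable def autCoordPair : Aut P → Lp ℝ 2 P × Lp ℝ 2 P :=
  Quotient.lift coordPair fun _ _ h => coordPair_eq_iff.2 (Quotient.sound h)

lemma isEmbedding_autCoordPair : IsEmbedding (autCoordPair : Aut P → _) := by
  refine ⟨⟨le_antisymm ?_ ?_⟩, ?_⟩
  · rw [← continuous_iff_le_induced]
    exact continuous_coordPair.quotient_lift _
  · intro U hU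
    have h1 : IsOpen ((QuotientGroup.mk : mpPerm P → Aut P) ⁻¹' U) :=
      hU.preimage QuotientGroup.continuous_mk
    obtain ⟨V, hV, hVU⟩ := isInducing_coordPair.isOpen_iff.1 h1
    refine isOpen_induced_iff.2 ⟨V, hV, ?_⟩
    ext g
    induction g using QuotientGroup.induction_on with
    | H e => exact iff_of_eq (congrFun (congrArg (fun s : Set _ => (· ∈ s)) hVU) e)
  · intro g h
    induction g using QuotientGroup.induction_on with
    | H e =>
      induction h using QuotientGroup.induction_on with
      | H e' => exact fun h => coordPair_eq_iff.1 h

/-- The first component alone determines the topology, but its limits include noninvertible maps;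
the second component forces the limit to be invertible mod 0. -/
lemma isClosed_range_coordPair [NullSingletonClass P] :
    IsClosed (range (coordPair : mpPerm P → _)) := by
  refine isClosed_of_closure_subset ?_
  rintro ⟨η, ζ⟩ hy
  set l : Filter (mpPerm P) := comap coordPair (𝓝 (η, ζ)) with hl
  have : NeBot l := comap_neBot_iff.2 fun t ht => by
    obtain ⟨_, hz, e, rfl⟩ := mem_closure_iff_nhds.1 hy t ht
    exact ⟨e, hz⟩
  have htend : Tendsto coordPair l (𝓝 (η, ζ)) := tendsto_comap
  have h1 : Tendsto (fun e : mpPerm P => koopPerm e (coordLp P)) l (𝓝 η) :=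
    (continuous_fst.tendsto _).comp htend
  have h2 : Tendsto (fun e : mpPerm P => koopPerm e⁻¹ (coordLp P)) l (𝓝 ζ) :=
    (continuous_snd.tendsto _).comp htend
  obtain ⟨S, hS, rfl⟩ := exists_koop_eq_of_tendsto (hT := fun e : mpPerm P => e.2.1) h1
  have hall := tendsto_koop_of_coordLp (hT := fun e : mpPerm P => e.2.1) (hS := hS) h1
  -- Applying the isometry `koopPerm e` turns the distance from `koopPerm e⁻¹ (coordLp P)` to `ζ`
  -- into the distance from the coordinate to `koopPerm e ζ`, which therefore tends to 0.
  have hSζ : koop hS ζ = coordLp P := by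
    refine tendsto_nhds_unique (hall ζ) (tendsto_iff_dist_tendsto_zero.2 ?_)
    refine (tendsto_iff_dist_tendsto_zero.1 h2).congr fun e => ?_
    conv_rhs => rw [← koopPerm_koopPerm_inv e (coordLp P)]
    rw [(koopPerm e).isometry.dist_eq, dist_comm]
  -- On this conull set `S ω` determines the coordinate of `ω`, so `S` is injective there.
  set A : Set Ω := {ω | coord Ω ω = ζ (S ω)}
  have hA : MeasurableSet A :=
    measurableSet_eq_fun (measurable_coord Ω) ((measurable_coeFn ζ).comp hS.measurable)
  have hA0 : P Aᶜ = 0 := by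
    have h' : koop hS ζ =ᵐ[P] coordLp P := by rw [hSζ]
    have : ∀ᵐ ω ∂P, ω ∈ A := by
      filter_upwards [coeFn_koop hS ζ, h', coeFn_coordLp P] with ω a b c
      change coord Ω ω = ζ (S ω)
      rw [← c, ← b, a, Function.comp_apply]
    exact this
  have hinj : InjOn S A := fun ω hω ω' hω' h => coord_injective (by
    rw [show coord Ω ω = ζ (S ω) from hω, show coord Ω ω' = ζ (S ω') from hω', h])
  obtain ⟨e, he, hae⟩ := exists_measurableEquiv_ae_eq hS hA hA0 hinj
  set g : mpPerm P := ⟨e.toEquiv, he, he.symm e⟩ with hg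
  have hgS : koopPerm g = koop hS := koop_congr _ _ hae
  refine ⟨g, Prod.ext ?_ ?_⟩
  · exact congrArg (· (coordLp P)) hgS
  · refine (koopPerm g).injective ?_
    change koopPerm g (koopPerm g⁻¹ (coordLp P)) = _
    rw [koopPerm_koopPerm_inv, hgS, hSζ]

instance [NullSingletonClass P] : PolishSpace (Aut P) := by
  refine IsClosedEmbedding.polishSpace (f := autCoordPair) ⟨isEmbedding_autCoordPair, ?_⟩
  have : range (autCoordPair : Aut P → _) = range (coordPair : mpPerm P → _) := by
    ext y
    constructor
    · rintro ⟨g, rfl⟩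
      induction g using QuotientGroup.induction_on with
      | H e => exact ⟨e, rfl⟩
    · rintro ⟨e, rfl⟩
      exact ⟨QuotientGroup.mk e, rfl⟩
  rw [this]
  exact isClosed_range_coordPair

end AutPolish

/-! ### Continuity of the action -/

section Action

variable {Ω : Type*} [mΩ : MeasurableSpace Ω] {P : Measure Ω} [IsProbabilityMeasure P]

lemma defect_smul_field (e : mpPerm P) (E : SubSigmaField P) (f : Lp ℝ 2 P) :
    (e • E).defect f = E.defect (koopPerm e f) := by
  have h := Metric.infEDist_image (t := ((e • E).toClosedSubspace : Set (Lp ℝ 2 P))) (x := f)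
    (Lp.isometry_compMeasurePreserving (E := ℝ) (p := 2) e.2.1)
  rw [SubSigmaField.image_toClosedSubspace_smul, SubSigmaField.infEDist_toClosedSubspace,
    SubSigmaField.infEDist_toClosedSubspace] at h
  exact ((ENNReal.ofReal_eq_ofReal_iff (E.defect_nonneg _) ((e • E).defect_nonneg _)).1 h).symm

lemma continuous_defect_uncurry :
    Continuous fun p : Lp ℝ 2 P × SubSigmaField P => p.2.defect p.1 :=
  continuous_prod_of_continuous_lipschitzWith _ 1 (fun f => SubSigmaField.continuous_defect f)
    fun E => E.lipschitzWith_defect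

lemma continuous_defect_smul_field (f : Lp ℝ 2 P) :
    Continuous fun p : mpPerm P × SubSigmaField P => (p.1 • p.2).defect f := by
  have h1 : Continuous fun p : mpPerm P × SubSigmaField P => koopPerm p.1 f :=
    (continuous_koopPerm f).comp continuous_fst
  have h2 : Continuous fun p : mpPerm P × SubSigmaField P => (koopPerm p.1 f, p.2) :=
    h1.prodMk continuous_snd
  have h3 := (continuous_defect_uncurry (P := P)).comp h2
  refine h3.congr fun p => ?_
  rw [defect_smul_field]
  rfl

lemma continuous_mpPerm_smul :
    Continuous fun p : mpPerm P × SubSigmaField P => p.1 • p.2 :=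
  SubSigmaField.isInducing_defect.continuous_iff.2
    (continuous_pi fun f => continuous_defect_smul_field f)

/-- A product of a quotient map with an identity need not be a quotient map; openness of the coset
projection ensures it, so joint continuity descends from `mpPerm P` to `Aut P`. -/
lemma isOpenQuotientMap_mk_prodMap_id : IsOpenQuotientMap
    (Prod.map (QuotientGroup.mk : mpPerm P → Aut P) (id : SubSigmaField P → SubSigmaField P)) :=
  QuotientGroup.isOpenQuotientMap_mk.prodMap IsOpenQuotientMap.id

instance : ContinuousSMul (Aut P) (SubSigmaField P) where
  continuous_smul := isOpenQuotientMap_mk_prodMap_id.isQuotientMap.continuous_iff.2 (by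
    refine continuous_mpPerm_smul.congr fun p => ?_
    exact (SubSigmaField.mk_smul p.1 p.2).symm)

variable [StandardBorelSpace Ω]

instance : ContinuousSMul (Aut P) (CondNonatomicField P) where
  continuous_smul := by
    refine Continuous.subtype_mk (f := fun p : Aut P × CondNonatomicField P => p.1 • p.2.1) ?_ _
    exact continuous_fst.smul (continuous_subtype_val.comp continuous_snd)

lemma continuousSMul_filtrationSpace {T : Set ℝ≥0∞} (hT : IsCompact T) :
    ContinuousSMul (Aut P) (FiltrationSpace P T) where
  continuous_smul := by
    have : CompactSpace T := isCompact_iff_compactSpace.1 hT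
    refine Continuous.subtype_mk (f := fun p : Aut P × FiltrationSpace P T => p.1 • p.2.1) ?_ _
    exact continuous_fst.smul (continuous_subtype_val.comp continuous_snd)

theorem isPolishGSpace [NullSingletonClass P] {T : Set ℝ≥0∞} (hT : IsCompact T) :
    IsPolishGSpace (Aut P) (FiltrationSpace P T) where
  isTopologicalGroup := inferInstance
  polishGroup := inferInstance
  polishSpace := polishSpace_filtrationSpace hT
  continuousSMul := continuousSMul_filtrationSpace hT

end Action

/-! ### Products of functions of two independent variables -/

section Tensor

variable {Ω : Type*} [mΩ : MeasurableSpace Ω] {P : Measure Ω} [IsProbabilityMeasure P]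
  {p q : Ω → Ω}

/-- By independence the product of the two integrable squares is integrable; in general a product of
two `L₂` functions is only in `L₁`. -/
lemma memLp_mul_comp (hp : MeasurePreserving p P P) (hq : MeasurePreserving q P P)
    (hpq : IndepFun p q P) (f g : Lp ℝ 2 P) : MemLp (fun ω => f (p ω) * g (q ω)) 2 P := by
  have hf := (measurable_coeFn f).comp hp.measurable
  have hg := (measurable_coeFn g).comp hq.measurable
  refine (memLp_two_iff_integrable_sq (hf.mul hg).aestronglyMeasurable).2 ?_
  have h1 : Integrable (fun ω => f (p ω) ^ 2) P :=
    hp.integrable_comp_of_integrable (Lp.memLp f).integrable_sq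
  have h2 : Integrable (fun ω => g (q ω) ^ 2) P :=
    hq.integrable_comp_of_integrable (Lp.memLp g).integrable_sq
  have hind : IndepFun (fun ω => f (p ω) ^ 2) (fun ω => g (q ω) ^ 2) P :=
    hpq.comp ((measurable_coeFn f).pow_const 2) ((measurable_coeFn g).pow_const 2)
  refine (hind.integrable_mul h1 h2).congr (Eventually.of_forall fun ω => ?_)
  simp [mul_pow]

/-- The element `f ∘ p * g ∘ q` of `L₂`. -/
noncomputable def tensor (hp : MeasurePreserving p P P) (hq : MeasurePreserving q P P)
    (hpq : IndepFun p q P) (f g : Lp ℝ 2 P) : Lp ℝ 2 P := (memLp_mul_comp hp hq hpq f g).toLp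

variable (hp : MeasurePreserving p P P) (hq : MeasurePreserving q P P) (hpq : IndepFun p q P)

lemma coeFn_tensor (f g : Lp ℝ 2 P) :
    tensor hp hq hpq f g =ᵐ[P] fun ω => f (p ω) * g (q ω) := MemLp.coeFn_toLp _

lemma tensor_sub_left (f f' g : Lp ℝ 2 P) :
    tensor hp hq hpq (f - f') g = tensor hp hq hpq f g - tensor hp hq hpq f' g := by
  ext1
  filter_upwards [coeFn_tensor hp hq hpq (f - f') g, coeFn_tensor hp hq hpq f g,
    coeFn_tensor hp hq hpq f' g, Lp.coeFn_sub (tensor hp hq hpq f g) (tensor hp hq hpq f' g),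
    hp.quasiMeasurePreserving.ae (Lp.coeFn_sub f f')] with ω h1 h2 h3 h4 h5
  rw [h1, h4, Pi.sub_apply, h2, h3, h5, Pi.sub_apply, sub_mul]

lemma tensor_sub_right (f g g' : Lp ℝ 2 P) :
    tensor hp hq hpq f (g - g') = tensor hp hq hpq f g - tensor hp hq hpq f g' := by
  ext1
  filter_upwards [coeFn_tensor hp hq hpq f (g - g'), coeFn_tensor hp hq hpq f g,
    coeFn_tensor hp hq hpq f g', Lp.coeFn_sub (tensor hp hq hpq f g) (tensor hp hq hpq f g'),
    hq.quasiMeasurePreserving.ae (Lp.coeFn_sub g g')] with ω h1 h2 h3 h4 h5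
  rw [h1, h4, Pi.sub_apply, h2, h3, h5, Pi.sub_apply, mul_sub]

lemma tensor_ind_ind {A B : Set Ω} (hA : MeasurableSet A) (hB : MeasurableSet B) :
    tensor hp hq hpq (ind P hA) (ind P hB) =
      ind P ((hp.measurable hA).inter (hq.measurable hB)) := by
  ext1
  filter_upwards [coeFn_tensor hp hq hpq (ind P hA) (ind P hB),
    coeFn_ind (P := P) ((hp.measurable hA).inter (hq.measurable hB)),
    hp.quasiMeasurePreserving.ae (coeFn_ind (P := P) hA),
    hq.quasiMeasurePreserving.ae (coeFn_ind (P := P) hB)] with ω h1 h2 h3 h4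
  rw [h1, h2, h3, h4]
  by_cases h : p ω ∈ A <;> by_cases h' : q ω ∈ B <;> simp [h, h']

lemma tensor_ind_univ (f : Lp ℝ 2 P) :
    tensor hp hq hpq f (ind P MeasurableSet.univ) = koop hp f := by
  ext1
  filter_upwards [coeFn_tensor hp hq hpq f (ind P MeasurableSet.univ), coeFn_koop hp f,
    hq.quasiMeasurePreserving.ae (coeFn_ind (P := P) MeasurableSet.univ)] with ω h1 h2 h3
  rw [h1, h2, h3]
  simp

lemma ind_univ_tensor (g : Lp ℝ 2 P) :
    tensor hp hq hpq (ind P MeasurableSet.univ) g = koop hq g := by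
  ext1
  filter_upwards [coeFn_tensor hp hq hpq (ind P MeasurableSet.univ) g, coeFn_koop hq g,
    hp.quasiMeasurePreserving.ae (coeFn_ind (P := P) MeasurableSet.univ)] with ω h1 h2 h3
  rw [h1, h2, h3]
  simp

/-- Independence factors the integral, so `tensor` behaves as the tensor product of Hilbert spaces.
-/
lemma inner_tensor (f g f' g' : Lp ℝ 2 P) :
    inner ℝ (tensor hp hq hpq f g) (tensor hp hq hpq f' g') = inner ℝ f f' * inner ℝ g g' := by
  rw [L2.inner_def, L2.inner_def, L2.inner_def]
  have hF : Measurable fun ω => f' ω * f ω := (measurable_coeFn f').mul (measurable_coeFn f)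
  have hG : Measurable fun ω => g' ω * g ω := (measurable_coeFn g').mul (measurable_coeFn g)
  have h1 := hpq.integral_fun_comp_mul_comp (f := fun ω => f' ω * f ω) (g := fun ω => g' ω * g ω)
    hp.measurable.aemeasurable hq.measurable.aemeasurable hF.aestronglyMeasurable
    hG.aestronglyMeasurable
  rw [← integral_map hp.measurable.aemeasurable hF.aestronglyMeasurable,
    ← integral_map hq.measurable.aemeasurable hG.aestronglyMeasurable, hp.map_eq, hq.map_eq] at h1
  refine Eq.trans (integral_congr_ae ?_) h1
  filter_upwards [coeFn_tensor hp hq hpq f g, coeFn_tensor hp hq hpq f' g'] with ω h2 h3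
  rw [h2, h3]
  change f' (p ω) * g' (q ω) * (f (p ω) * g (q ω)) = _
  ring

lemma norm_tensor (f g : Lp ℝ 2 P) : ‖tensor hp hq hpq f g‖ = ‖f‖ * ‖g‖ := by
  have h := inner_tensor hp hq hpq f g f g
  simp only [real_inner_self_eq_norm_sq, ← mul_pow] at h
  exact (sq_eq_sq₀ (norm_nonneg _) (by positivity)).1 h

lemma tendsto_tensor {ι : Type*} {l : Filter ι} {u v : ι → Lp ℝ 2 P} {f g : Lp ℝ 2 P}
    (hu : Tendsto u l (𝓝 f)) (hv : Tendsto v l (𝓝 g)) :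
    Tendsto (fun i => tensor hp hq hpq (u i) (v i)) l (𝓝 (tensor hp hq hpq f g)) := by
  have hlim : Tendsto (fun i => ‖u i - f‖ * ‖v i‖ + ‖f‖ * ‖v i - g‖) l (𝓝 (0 * ‖g‖ + ‖f‖ * 0)) :=
    ((tendsto_iff_norm_sub_tendsto_zero.1 hu).mul hv.norm).add
      (tendsto_const_nhds.mul (tendsto_iff_norm_sub_tendsto_zero.1 hv))
  rw [zero_mul, mul_zero, add_zero] at hlim
  refine tendsto_iff_norm_sub_tendsto_zero.2
    (squeeze_zero (fun _ => norm_nonneg _) (fun i => ?_) hlim)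
  have h : tensor hp hq hpq (u i) (v i) - tensor hp hq hpq f g =
      tensor hp hq hpq (u i - f) (v i) + tensor hp hq hpq f (v i - g) := by
    rw [tensor_sub_left, tensor_sub_right]
    abel
  rw [h, ← norm_tensor hp hq hpq, ← norm_tensor hp hq hpq]
  exact norm_add_le _ _

end Tensor

/-! ### Joining two sub-σ-fields independently -/

section Join

lemma sup_comap_eq_generateFrom {α β γ : Type*} {m₁ : MeasurableSpace β} {m₂ : MeasurableSpace γ}
    (p : α → β) (q : α → γ) : m₁.comap p ⊔ m₂.comap q = MeasurableSpace.generateFrom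
      (image2 (fun A B => p ⁻¹' A ∩ q ⁻¹' B) {A | MeasurableSet A} {B | MeasurableSet B}) := by
  refine le_antisymm (sup_le ?_ ?_) (MeasurableSpace.generateFrom_le ?_)
  · rintro _ ⟨A, hA, rfl⟩
    exact MeasurableSpace.measurableSet_generateFrom
      ⟨A, hA, univ, MeasurableSet.univ, by simp⟩
  · rintro _ ⟨B, hB, rfl⟩
    exact MeasurableSpace.measurableSet_generateFrom
      ⟨univ, MeasurableSet.univ, B, hB, by simp⟩
  · rintro _ ⟨A, hA, B, hB, rfl⟩
    exact MeasurableSet.inter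
      (le_sup_left (a := m₁.comap p) (b := m₂.comap q) _ ⟨A, hA, rfl⟩)
      (le_sup_right (a := m₁.comap p) (b := m₂.comap q) _ ⟨B, hB, rfl⟩)

lemma isPiSystem_image2_preimage_inter {α β γ : Type*} {m₁ : MeasurableSpace β}
    {m₂ : MeasurableSpace γ} (p : α → β) (q : α → γ) : IsPiSystem
      (image2 (fun A B => p ⁻¹' A ∩ q ⁻¹' B) {A | MeasurableSet A} {B | MeasurableSet B}) := by
  rintro _ ⟨A, hA, B, hB, rfl⟩ _ ⟨A', hA', B', hB', rfl⟩ -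
  exact ⟨A ∩ A', MeasurableSet.inter hA hA', B ∩ B', MeasurableSet.inter hB hB',
    by simp only [preimage_inter]; exact inter_inter_inter_comm _ _ _ _⟩

variable {Ω : Type*} [mΩ : MeasurableSpace Ω] {P : Measure Ω} [IsProbabilityMeasure P]
  {p q : Ω → Ω} (hp : MeasurePreserving p P P) (hq : MeasurePreserving q P P)
  (hpq : IndepFun p q P) (F E : SubSigmaField P)

lemma sup_comap_le (hp : MeasurePreserving p P P) (hq : MeasurePreserving q P P)
    (F E : SubSigmaField P) :
    F.toMeasurableSpace.comap p ⊔ E.toMeasurableSpace.comap q ≤ mΩ :=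
  sup_le ((MeasurableSpace.comap_mono F.le).trans hp.measurable.comap_le)
    ((MeasurableSpace.comap_mono E.le).trans hq.measurable.comap_le)

/-- The sub-σ-field generated by the preimages of two sub-σ-fields. -/
def join : SubSigmaField P :=
  SubSigmaField.completion P (sup_comap_le hp hq F E)

variable {F E}

lemma tensor_mem_join {f g : Lp ℝ 2 P} (hf : f ∈ F.space) (hg : g ∈ E.space) :
    tensor hp hq hpq f g ∈ (join hp hq F E).space := by
  rw [join, SubSigmaField.space_completion]
  obtain ⟨f', hf', hff'⟩ := hf
  obtain ⟨g', hg', hgg'⟩ := hg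
  have h1 : StronglyMeasurable[F.toMeasurableSpace.comap p ⊔ E.toMeasurableSpace.comap q]
      (f' ∘ p) := hf'.comp_measurable fun s hs =>
    le_sup_left (a := F.toMeasurableSpace.comap p) (b := E.toMeasurableSpace.comap q) _ ⟨s, hs, rfl⟩
  have h2 : StronglyMeasurable[F.toMeasurableSpace.comap p ⊔ E.toMeasurableSpace.comap q]
      (g' ∘ q) := hg'.comp_measurable fun s hs =>
    le_sup_right (a := F.toMeasurableSpace.comap p) (b := E.toMeasurableSpace.comap q) _
      ⟨s, hs, rfl⟩
  refine ⟨_, h1.mul h2, ?_⟩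
  filter_upwards [coeFn_tensor hp hq hpq f g, hp.quasiMeasurePreserving.ae hff',
    hq.quasiMeasurePreserving.ae hgg'] with ω h3 h4 h5
  rw [h3, h4, h5]
  rfl

/-- The rectangles `p⁻¹A ∩ q⁻¹B` form a generating π-system, and their indicators are tensors of
indicators. -/
lemma join_space_le {K : Submodule ℝ (Lp ℝ 2 P)} (hK : IsClosed (K : Set (Lp ℝ 2 P)))
    (h : ∀ f ∈ F.space, ∀ g ∈ E.space, tensor hp hq hpq f g ∈ K) :
    (join hp hq F E).space ≤ K := by
  have key : ∀ {A B : Set Ω}, MeasurableSet[F.toMeasurableSpace] A →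
      MeasurableSet[E.toMeasurableSpace] B → ∀ hs : MeasurableSet (p ⁻¹' A ∩ q ⁻¹' B),
      ind P hs ∈ K := fun {A B} hA hB hs => by
    have := h _ ((SubSigmaField.ind_mem_space (F.le A hA)).2 hA) _
      ((SubSigmaField.ind_mem_space (E.le B hB)).2 hB)
    rwa [tensor_ind_ind] at this
  rw [join, SubSigmaField.space_completion]
  refine lpMeas_le_of_generateFrom (sup_comap_le hp hq F E) (sup_comap_eq_generateFrom p q)
    (isPiSystem_image2_preimage_inter p q) hK ?_ ?_
  · rw [ind_congr MeasurableSet.univ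
      ((hp.measurable MeasurableSet.univ).inter (hq.measurable MeasurableSet.univ)) (by simp)]
    exact key (@MeasurableSet.univ _ F.toMeasurableSpace) (@MeasurableSet.univ _ E.toMeasurableSpace) _
  · rintro _ ⟨A, hA, B, hB, rfl⟩ hs
    exact key hA hB hs

/-- Conditional expectations given an independent join are products of conditional expectations. -/
theorem proj_join_tensor (f g : Lp ℝ 2 P) :
    (join hp hq F E).proj (tensor hp hq hpq f g) = tensor hp hq hpq (F.proj f) (E.proj g) := by
  refine Submodule.eq_starProjection_of_mem_of_inner_eq_zero
    (tensor_mem_join hp hq hpq (F.proj_mem f) (E.proj_mem g)) fun k hk => ?_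
  -- Orthogonality to the fixed difference defines a closed subspace, so it is enough to check it on
  -- tensors, where inner products factor.
  have hle : (join hp hq F E).space ≤
      (ℝ ∙ (tensor hp hq hpq f g - tensor hp hq hpq (F.proj f) (E.proj g)))ᗮ := by
    refine join_space_le hp hq hpq (Submodule.isClosed_orthogonal _) fun f' hf' g' hg' => ?_
    rw [Submodule.mem_orthogonal_singleton_iff_inner_right, inner_sub_left, inner_tensor,
      inner_tensor]
    have h1 : inner ℝ (F.proj f) f' = inner ℝ f f' := by
      have := Submodule.starProjection_inner_eq_zero (K := F.space) f f' hf'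
      rw [inner_sub_left, sub_eq_zero] at this
      exact this.symm
    have h2 : inner ℝ (E.proj g) g' = inner ℝ g g' := by
      have := Submodule.starProjection_inner_eq_zero (K := E.space) g g' hg'
      rw [inner_sub_left, sub_eq_zero] at this
      exact this.symm
    rw [h1, h2, sub_self]
  exact Submodule.mem_orthogonal_singleton_iff_inner_right.1 (hle hk)

lemma proj_ind_univ (E : SubSigmaField P) :
    E.proj (ind P MeasurableSet.univ) = ind P MeasurableSet.univ :=
  SubSigmaField.proj_eq_self.2 E.ind_univ_mem_space

lemma proj_join_koop_left (hpq : IndepFun p q P) (f : Lp ℝ 2 P) :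
    (join hp hq F E).proj (koop hp f) = koop hp (F.proj f) := by
  rw [← tensor_ind_univ hp hq hpq, proj_join_tensor, proj_ind_univ, tensor_ind_univ]

lemma proj_join_koop_right (hpq : IndepFun p q P) (f : Lp ℝ 2 P) :
    (join hp hq F E).proj (koop hq f) = koop hq (E.proj f) := by
  rw [← ind_univ_tensor hp hq hpq, proj_join_tensor, proj_ind_univ, ind_univ_tensor]

/-- Seen through `p`, the join is indistinguishable from `F`: functions of `p` are tensors with 1,
and the field `E` does not affect their conditional expectations. -/
lemma defect_join_koop_left (hpq : IndepFun p q P) (f : Lp ℝ 2 P) :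
    (join hp hq F E).defect (koop hp f) = F.defect f := by
  rw [SubSigmaField.defect, proj_join_koop_left hp hq hpq, ← map_sub, LinearIsometry.norm_map,
    SubSigmaField.defect]

lemma defect_join_koop_right (hpq : IndepFun p q P) (f : Lp ℝ 2 P) :
    (join hp hq F E).defect (koop hq f) = E.defect f := by
  rw [SubSigmaField.defect, proj_join_koop_right hp hq hpq, ← map_sub, LinearIsometry.norm_map,
    SubSigmaField.defect]

lemma join_mono {F' E' : SubSigmaField P} (hF : F.toMeasurableSpace ≤ F'.toMeasurableSpace)
    (hE : E.toMeasurableSpace ≤ E'.toMeasurableSpace) :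
    (join hp hq F E).toMeasurableSpace ≤ (join hp hq F' E').toMeasurableSpace :=
  SubSigmaField.completion_mono _ _
    (sup_le_sup (MeasurableSpace.comap_mono hF) (MeasurableSpace.comap_mono hE))

lemma mem_space_bot {f : Lp ℝ 2 P} {c : ℝ} (hf : f =ᵐ[P] fun _ => c) :
    f ∈ (SubSigmaField.completion P (bot_le : (⊥ : MeasurableSpace Ω) ≤ mΩ)).space := by
  rw [SubSigmaField.space_completion]
  exact ⟨fun _ => c, stronglyMeasurable_const, hf⟩

lemma exists_ae_eq_of_mem_space_bot {f : Lp ℝ 2 P}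
    (hf : f ∈ (SubSigmaField.completion P (bot_le : (⊥ : MeasurableSpace Ω) ≤ mΩ)).space) :
    ∃ c : ℝ, f =ᵐ[P] fun _ => c := by
  rw [SubSigmaField.space_completion] at hf
  obtain ⟨f', hf', hff'⟩ := hf
  obtain ⟨c, hc⟩ := stronglyMeasurable_bot_iff.1 hf'
  exact ⟨c, hff'.trans (Eventually.of_forall fun ω => congrFun hc ω)⟩

lemma isTrivial_join (hpq : IndepFun p q P) (hF : F.IsTrivial) (hE : E.IsTrivial) :
    (join hp hq F E).IsTrivial := by
  rw [SubSigmaField.isTrivial_iff] at hF hE ⊢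
  refine SubSigmaField.le_of_space_le (join_space_le hp hq hpq (SubSigmaField.isClosed_space _)
    fun f hf g hg => ?_)
  obtain ⟨c, hc⟩ := exists_ae_eq_of_mem_space_bot (SubSigmaField.space_mono hF hf)
  obtain ⟨d, hd⟩ := exists_ae_eq_of_mem_space_bot (SubSigmaField.space_mono hE hg)
  refine mem_space_bot (c := c * d) ?_
  filter_upwards [coeFn_tensor hp hq hpq f g, hp.quasiMeasurePreserving.ae hc,
    hq.quasiMeasurePreserving.ae hd] with ω h1 h2 h3
  rw [h1, h2, h3]

/-- One conditionally nonatomic factor suffices: partitions pulled back by `p` have the same mean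
sums of squares given the join as the original ones given `F`. -/
lemma isCondNonatomic_join [StandardBorelSpace Ω] (hpq : IndepFun p q P)
    (hF : F.IsCondNonatomic) : (join hp hq F E).IsCondNonatomic := by
  refine SubSigmaField.isCondNonatomic_of_forall_exists fun k => ?_
  obtain ⟨n, hn⟩ := SubSigmaField.isCondNonatomic_iff.1 hF k
  have h : ∀ j, ‖(join hp hq F E).proj (ind P (((measurable_label n).comp hp.measurable)
      (measurableSet_singleton j)))‖ =
      ‖F.proj (ind P ((measurable_label n) (measurableSet_singleton j)))‖ := fun j => by
    have h1 := proj_join_koop_left (E := E) (F := F) hp hq hpq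
      (ind P ((measurable_label n) (measurableSet_singleton j)))
    rw [koop_ind] at h1
    exact (congrArg norm h1).trans ((koop hp).norm_map _)
  refine ⟨label n ∘ p, (measurable_label n).comp hp.measurable, n + 1, fun ω => label_lt n _, ?_⟩
  unfold SubSigmaField.meanSumSq at hn ⊢
  simp_rw [h]
  exact hn

/-- The elements of `L₂` whose conditional expectations converge. -/
noncomputable def projLimitSpace {ι : Type*} (l : Filter ι) (G : ι → SubSigmaField P)
    (G₀ : SubSigmaField P) : Submodule ℝ (Lp ℝ 2 P) where
  carrier := {h | Tendsto (fun t => (G t).proj h) l (𝓝 (G₀.proj h))}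
  zero_mem' := by
    simp only [mem_ofPred_eq, map_zero]
    exact tendsto_const_nhds
  add_mem' := fun {f g} hf hg => by
    simp only [mem_ofPred_eq, map_add] at hf hg ⊢
    exact hf.add hg
  smul_mem' := fun c f hf => by
    simp only [mem_ofPred_eq, map_smul] at hf ⊢
    exact hf.const_smul c

lemma mem_projLimitSpace {ι : Type*} {l : Filter ι} {G : ι → SubSigmaField P}
    {G₀ : SubSigmaField P} {h : Lp ℝ 2 P} : h ∈ projLimitSpace l G G₀ ↔
      Tendsto (fun t => (G t).proj h) l (𝓝 (G₀.proj h)) := Iff.rfl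

lemma isClosed_projLimitSpace {ι : Type*} {l : Filter ι} {G : ι → SubSigmaField P}
    {G₀ : SubSigmaField P} : IsClosed (projLimitSpace l G G₀ : Set (Lp ℝ 2 P)) :=
  isClosed_setOf_tendsto (fun t => (G t).lipschitzWith_proj) G₀.lipschitzWith_proj

lemma eq_top_of_tensor_mem (hpq : IndepFun p q P) (hgen : mΩ.comap p ⊔ mΩ.comap q = mΩ)
    {K : Submodule ℝ (Lp ℝ 2 P)} (hK : IsClosed (K : Set (Lp ℝ 2 P)))
    (hmem : ∀ f g, tensor hp hq hpq f g ∈ K) : K = ⊤ := by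
  refine eq_top_of_generateFrom (hgen.symm.trans (sup_comap_eq_generateFrom p q))
    (isPiSystem_image2_preimage_inter p q) hK ?_ ?_
  · have := hmem (ind P MeasurableSet.univ) (ind P MeasurableSet.univ)
    rwa [tensor_ind_univ] at this
  · rintro _ ⟨A, hA, B, hB, rfl⟩ hs
    have := hmem (ind P hA) (ind P hB)
    rwa [tensor_ind_ind] at this

/-- On tensors the projection is the tensor of two continuous projections. Since `p` and `q`
generate, tensors lie in no proper closed subspace, and the set of good `h` is a closed subspace. -/
lemma continuous_proj_join {S : Type*} [TopologicalSpace S] {F E : S → SubSigmaField P}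
    (hF : Continuous F) (hE : Continuous E) (hpq : IndepFun p q P)
    (hgen : mΩ.comap p ⊔ mΩ.comap q = mΩ) (h : Lp ℝ 2 P) :
    Continuous fun s => (join hp hq (F s) (E s)).proj h := by
  rw [continuous_iff_continuousAt]
  intro s
  have hmem : ∀ f g, Tendsto (fun t => (join hp hq (F t) (E t)).proj (tensor hp hq hpq f g)) (𝓝 s)
      (𝓝 ((join hp hq (F s) (E s)).proj (tensor hp hq hpq f g))) := fun f g => by
    have h1 : Tendsto (fun t => (F t).proj f) (𝓝 s) (𝓝 ((F s).proj f)) :=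
      ((SubSigmaField.continuous_proj f).tendsto (F s)).comp (hF.tendsto s)
    have h2 : Tendsto (fun t => (E t).proj g) (𝓝 s) (𝓝 ((E s).proj g)) :=
      ((SubSigmaField.continuous_proj g).tendsto (E s)).comp (hE.tendsto s)
    rw [proj_join_tensor]
    exact (tendsto_tensor hp hq hpq h1 h2).congr fun t => (proj_join_tensor hp hq hpq f g).symm
  have htop : projLimitSpace (𝓝 s) (fun t => join hp hq (F t) (E t)) (join hp hq (F s) (E s)) = ⊤ :=
    eq_top_of_tensor_mem hp hq hpq hgen isClosed_projLimitSpace hmem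
  rw [ContinuousAt, ← mem_projLimitSpace, htop]
  trivial

lemma continuous_join {S : Type*} [TopologicalSpace S] {F E : S → SubSigmaField P}
    (hF : Continuous F) (hE : Continuous E) (hpq : IndepFun p q P)
    (hgen : mΩ.comap p ⊔ mΩ.comap q = mΩ) :
    Continuous fun s => join hp hq (F s) (E s) :=
  SubSigmaField.isInducing_defect.continuous_iff.2 (continuous_pi fun f =>
    (continuous_const.sub (continuous_proj_join hp hq hF hE hpq hgen f)).norm)

end Join

/-! ### Independent copies and approximation by automorphisms -/

section Copies

variable {Ω : Type*} [mΩ : MeasurableSpace Ω] [StandardBorelSpace Ω] (P : Measure Ω)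
  [IsProbabilityMeasure P] [NullSingletonClass P]

/-- A nonatomic standard Borel probability space is the product of two copies of itself. -/
lemma exists_indepFun_generating : ∃ p q : Ω → Ω, MeasurePreserving p P P ∧
    MeasurePreserving q P P ∧ IndepFun p q P ∧ mΩ.comap p ⊔ mΩ.comap q = mΩ := by
  obtain ⟨α, hα, -⟩ := exists_measurableEquiv_labelled (P := P) (P' := P.prod P)
    (κ := fun _ => 0) (κ' := fun _ => 0) measurable_const measurable_const (by simp)
  have hp : MeasurePreserving (Prod.fst ∘ α) P P := measurePreserving_fst.comp hα
  have hq : MeasurePreserving (Prod.snd ∘ α) P P := measurePreserving_snd.comp hα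
  refine ⟨Prod.fst ∘ α, Prod.snd ∘ α, hp, hq, ?_, ?_⟩
  · rw [indepFun_iff_map_prod_eq_prod_map_map hp.measurable.aemeasurable
      hq.measurable.aemeasurable, hp.map_eq, hq.map_eq]
    exact hα.map_eq
  · rw [← MeasurableSpace.comap_comp, ← MeasurableSpace.comap_comp, ← MeasurableSpace.comap_sup]
    exact α.measurableEmbedding.comap_eq

variable {P}

/-- Every measure preserving map is a limit of invertible measure preserving maps. -/
lemma exists_tendsto_koopPerm {p : Ω → Ω} (hp : MeasurePreserving p P P) :
    ∃ h : ℕ → mpPerm P, ∀ f, Tendsto (fun n => koopPerm (h n) f) atTop (𝓝 (koop hp f)) := by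
  -- As `p` preserves the measure, `label n ∘ p` and `label n` have the same law. Matching labels
  -- puts the coordinates of `e ω` and `p ω` within `1 / n`.
  have hex : ∀ n, ∃ e : Ω ≃ᵐ Ω, MeasurePreserving e P P ∧ ∀ᵐ ω ∂P, label n (e ω) = label n (p ω) :=
    fun n => exists_measurableEquiv_labelled (κ := label n ∘ p) (κ' := label n)
      ((measurable_label n).comp hp.measurable) (measurable_label n) (by
        rw [← Measure.map_map (measurable_label n) hp.measurable, hp.map_eq])
  choose e he hlab using hex
  refine ⟨fun n => ⟨(e n).toEquiv, he n, (he n).symm (e n)⟩, ?_⟩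
  refine tendsto_koop_of_coordLp ?_
  refine tendsto_iff_norm_sub_tendsto_zero.2
    (squeeze_zero' (Eventually.of_forall fun _ => norm_nonneg _) ?_
      (tendsto_one_div_atTop_nhds_zero_nat (𝕜 := ℝ)))
  filter_upwards [eventually_gt_atTop 0] with n hn
  have hn' : (0 : ℝ) < n := by exact_mod_cast hn
  have hbound : ∀ᵐ ω ∂P, ‖(koop (he n) (coordLp P) - koop hp (coordLp P) : Lp ℝ 2 P) ω‖ ≤
      1 / (n : ℝ) := by
    filter_upwards [Lp.coeFn_sub (koop (he n) (coordLp P)) (koop hp (coordLp P)),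
      coeFn_koop (he n) (coordLp P), coeFn_koop hp (coordLp P), hlab n,
      (he n).quasiMeasurePreserving.ae (coeFn_coordLp P),
      hp.quasiMeasurePreserving.ae (coeFn_coordLp P)] with ω h1 h2 h3 h4 h5 h6
    rw [h1, Pi.sub_apply, h2, h3, Function.comp_apply, Function.comp_apply, h5, h6,
      Real.norm_eq_abs, le_div_iff₀ hn', mul_comm]
    exact (abs_coord_sub_lt h4).le
  have := Lp.norm_le_of_ae_bound (by positivity) hbound
  simpa [measureUnivNNReal] using this

end Copies

/-! ### Convergence of filtrations -/

section FiltrationConvergence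

variable {Ω : Type*} [mΩ : MeasurableSpace Ω] [StandardBorelSpace Ω] {P : Measure Ω}
  [IsProbabilityMeasure P] {T : Set ℝ≥0∞}

/-- The fields embed into functions on `L₂` with the product uniformity, where uniform convergence
in `t` may be tested for one `f` at a time. -/
lemma tendsto_filtrationSpace {ι : Type*} {l : Filter ι} {u : ι → FiltrationSpace P T}
    {x : FiltrationSpace P T} [CompactSpace T]
    (h : ∀ f, TendstoUniformly (fun i t => (u i).1 t |>.1.defect f)
      (fun t => (x.1 t).1.defect f) l) : Tendsto u l (𝓝 x) := by
  let D : C(CondNonatomicField P, Lp ℝ 2 P → ℝ) :=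
    ⟨fun E => E.1.defect, continuous_pi fun f =>
      (SubSigmaField.continuous_defect f).comp continuous_subtype_val⟩
  have hD : IsInducing D := SubSigmaField.isInducing_defect.comp IsInducing.subtypeVal
  refine (IsInducing.comp (D.isInducing_postcomp hD)
    (IsInducing.subtypeVal (t := {x : C(T, CondNonatomicField P) | IsFiltration x}))).tendsto_nhds_iff.2 ?_
  rw [ContinuousMap.tendsto_iff_tendstoUniformly, tendstoUniformly_iff_tendsto, Pi.uniformity,
    tendsto_iInf]
  exact fun f => tendsto_comap_iff.2 (tendstoUniformly_iff_tendsto.1 (h f))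

variable [NullSingletonClass P]

/-- The filtration generated by two independent filtrations. -/
noncomputable def joinFiltration {p q : Ω → Ω} (hp : MeasurePreserving p P P) (hq : MeasurePreserving q P P)
    (hpq : IndepFun p q P) (hgen : mΩ.comap p ⊔ mΩ.comap q = mΩ) (x y : FiltrationSpace P T) :
    FiltrationSpace P T :=
  ⟨⟨fun t => ⟨join hp hq (x.1 t).1 (y.1 t).1, isCondNonatomic_join hp hq hpq (x.1 t).2⟩,
    (continuous_join hp hq (continuous_subtype_val.comp x.1.continuous)
      (continuous_subtype_val.comp y.1.continuous) hpq hgen).subtype_mk _⟩,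
    fun s t hst => join_mono hp hq (x.2.mono s t hst) (y.2.mono s t hst),
    fun t ht => isTrivial_join hp hq hpq (x.2.trivial_of_least t ht) (y.2.trivial_of_least t ht)⟩

/-- If a filtration becomes `x` under a measure preserving map, then `x` is in the closure of its
orbit. -/
lemma mem_closure_orbit [CompactSpace T] {x z : FiltrationSpace P T} {p : Ω → Ω}
    (hp : MeasurePreserving p P P)
    (h : ∀ t f, (z.1 t).1.defect (koop hp f) = (x.1 t).1.defect f) :
    x ∈ closure (MulAction.orbit (Aut P) z) := by
  obtain ⟨e, he⟩ := exists_tendsto_koopPerm hp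
  refine mem_closure_of_tendsto (f := fun n => (QuotientGroup.mk (e n) : Aut P) • z) (b := atTop)
    (tendsto_filtrationSpace fun f => ?_) (Eventually.of_forall fun n => ⟨_, rfl⟩)
  refine Metric.tendstoUniformly_iff.2 fun ε hε => ?_
  -- The same `n` serves all `t`, because every distance function has Lipschitz constant 1.
  filter_upwards [Metric.tendsto_nhds.1 (he f) ε hε] with n hn t
  have h1 : ((((QuotientGroup.mk (e n) : Aut P) • z).1 t).1).defect f =
      (z.1 t).1.defect (koopPerm (e n) f) := defect_smul_field (e n) (z.1 t).1 f
  rw [h1, ← h, dist_comm]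
  exact ((z.1 t).1.lipschitzWith_defect.dist_le_mul _ _).trans_lt (by simpa using hn)

/-- Any two filtrations are in the closure of a common orbit. -/
lemma exists_mem_closure_orbit [CompactSpace T] (x y : FiltrationSpace P T) :
    ∃ z : FiltrationSpace P T, x ∈ closure (MulAction.orbit (Aut P) z) ∧
      y ∈ closure (MulAction.orbit (Aut P) z) := by
  obtain ⟨p, q, hp, hq, hpq, hgen⟩ := exists_indepFun_generating P
  exact ⟨joinFiltration hp hq hpq hgen x y,
    mem_closure_orbit hp fun t f => defect_join_koop_left hp hq hpq f,
    mem_closure_orbit hq fun t f => defect_join_koop_right hp hq hpq f⟩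

end FiltrationConvergence

/-! ### The topological zero-one law -/

/-- An invariant set with the Baire property is meager or comeager if any two points are in the
closure of a common orbit. -/
theorem isMeagre_or_mem_residual {G X : Type*} [Group G] [TopologicalSpace X] [BaireSpace X]
    [MulAction G X] [ContinuousConstSMul G X]
    (h : ∀ x y : X, ∃ z, x ∈ closure (MulAction.orbit G z) ∧ y ∈ closure (MulAction.orbit G z))
    {A : Set X} (hA : ∀ g : G, ∀ x ∈ A, g • x ∈ A) (hb : BaireMeasurableSet A) :
    IsMeagre A ∨ A ∈ residual X := by
  obtain ⟨U, hU, hAU⟩ := hb.residualEq_isOpen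
  obtain ⟨V, hV, hAV⟩ := hb.compl.residualEq_isOpen
  rcases U.eq_empty_or_nonempty with rfl | ⟨x, hx⟩
  · left
    filter_upwards [hAU.mem_iff] with a ha
    exact fun haA => ha.1 haA
  rcases V.eq_empty_or_nonempty with rfl | ⟨y, hy⟩
  · right
    filter_upwards [hAV.mem_iff] with a ha
    exact not_not.1 ha.1
  exfalso
  obtain ⟨z, hzx, hzy⟩ := h x y
  obtain ⟨_, hgU, g, rfl⟩ := mem_closure_iff.1 hzx U hU hx
  obtain ⟨_, hgV, g', rfl⟩ := mem_closure_iff.1 hzy V hV hy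
  -- This element moves the orbit point `g • z` of `U` to the orbit point `g' • z` of `V`.
  set k := g' * g⁻¹ with hk
  have hkz : k • g • z = g' • z := by rw [hk, smul_smul, inv_mul_cancel_right]
  have hW : IsOpen (U ∩ (fun a => k • a) ⁻¹' V) := hU.inter (hV.preimage (continuous_const_smul k))
  have htend : Tendsto (fun a : X => k • a) (residual X) (residual X) :=
    (Homeomorph.smul k).residual_map_eq.le
  -- Both agreements hold generically, since translation by `k` is a homeomorphism; by the Baire
  -- property of the space they hold at some point of the open set above.
  have hdense : Dense {a | (a ∈ A ↔ a ∈ U) ∧ (k • a ∈ Aᶜ ↔ k • a ∈ V)} :=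
    dense_of_mem_residual (hAU.mem_iff.and (htend.eventually hAV.mem_iff))
  obtain ⟨a, ⟨haU, hkaV⟩, ha1, ha2⟩ := hdense.inter_open_nonempty _ hW
    ⟨g • z, hgU, by rwa [mem_preimage, hkz]⟩
  exact ha2.2 hkaV (hA k a (ha1.2 haU))

end ProbSpace

theorem mainTheorem1 {Ω : Type*} [MeasurableSpace Ω] [StandardBorelSpace Ω]
    (P : Measure Ω) [IsProbabilityMeasure P] [NullSingletonClass P]
    (T : Set ℝ≥0∞) (hT : IsCompact T) :
    IsErgodicGSpace (ProbSpace.Aut P) (ProbSpace.FiltrationSpace P T) := by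
  have hP := ProbSpace.isPolishGSpace (P := P) hT
  have := hP.polishSpace
  have := hP.continuousSMul
  have : CompactSpace T := isCompact_iff_compactSpace.1 hT
  exact ⟨hP, fun A hA hb =>
    ProbSpace.isMeagre_or_mem_residual ProbSpace.exists_mem_closure_orbit hA hb⟩
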